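/- The boxicity $\mathrm{box}(H)$ of a finite graph $H$ is the least $d\ge 0$ such that $H$ is the intersection graph of axis-parallel boxes (products of $d$ non-empty closed bounded intervals) in $\mathbb{R}^d$. For a finite simple graph $G$, let $\overline{L(G)}$ denote the complement of its line graph. Theorem. There are a single algorithm and a constant $C$ such that, given (the adjacency matrix of) any graph $G$ on $n$ vertices and any positive integer $k$, the algorithm decides whether $\mathrm{box}(\overline{L(G)})\le k$ in at most $C\,n^{5k+3}+C$ steps; that is, the decision takes $O(n^{5k+3})$ time. Neither the algorithm nor $C$ depends on $n$, $k$ or $G$. The model of computation is the word RAM: addition, truncated subtraction, multiplication, integer division, memory access and tests for zero cost one step each, and the numbers occurring are bounded by a fixed power of $n+k+2$ (words of $O(\log(n+k+2))$ bits). In particular, the problem of deciding, for given $G$ and $k\ge 1$, whether $\mathrm{box}(\overline{L(G)})\le k$, with parameter $k$, belongs to XP: there is a computable function $f$ such that a single algorithm decides every instance $(G,k)$ in at most $f(k)\,(n+1)^{f(k)}$ steps. -/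

import Mathlib

/-! ### Boxicity -/

/-- `H` is the intersection graph of a family `(B v)` of axis-parallel boxes in `ℝ^d`, one for each
vertex. The box of `v` is the product over `i : Fin d` of the non-empty closed intervals
`[lo v i, hi v i]`, that is, the order interval `Set.Icc (lo v) (hi v)` of `Fin d → ℝ`. -/
def HasBoxRepresentation {V : Type*} (H : SimpleGraph V) (d : ℕ) : Prop :=
  ∃ lo hi : V → Fin d → ℝ, (∀ v i, lo v i ≤ hi v i) ∧
    ∀ u v : V, u ≠ v →
      (H.Adj u v ↔ (Set.Icc (lo u) (hi u) ∩ Set.Icc (lo v) (hi v)).Nonempty)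

/-- The boxicity of a graph: the least dimension `d` in which it has a box representation
(`⊤` if there is none, which does not happen for finite graphs). -/
noncomputable def boxicity {V : Type*} (H : SimpleGraph V) : ℕ∞ :=
  ⨅ d ∈ {d : ℕ | HasBoxRepresentation H d}, (d : ℕ∞)

/-! ### A word RAM

Programs are structured (sequences, branches, loops) over the usual instructions of a random access
machine. Every instruction and every test costs one step. All numbers that a program computes have
to be smaller than a bound `W` (machine words of `log₂ W` bits); an execution that would produce a
larger number is stuck. -/

namespace WordRAM

/-- The binary operations on words; subtraction is truncated at `0`, division is integer division
(with value `0` if the divisor is `0`). -/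
inductive BinOp : Type
  | add
  | sub
  | mul
  | div

/-- The value of a binary operation. -/
def BinOp.eval : BinOp → ℕ → ℕ → ℕ
  | .add, x, y => x + y
  | .sub, x, y => x - y
  | .mul, x, y => x * y
  | .div, x, y => x / y

/-- Programs. Registers are named by natural numbers; a program mentions only finitely many. -/
inductive Program : Type
  /-- do nothing -/
  | skip : Program
  /-- `reg r := c` -/
  | const (r c : ℕ) : Program
  /-- `reg r := reg a ∘ reg b` -/
  | op (o : BinOp) (r a b : ℕ) : Program
  /-- `reg r := mem[reg a]` -/
  | load (r a : ℕ) : Program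
  /-- `mem[reg a] := reg b` -/
  | store (a b : ℕ) : Program
  /-- first `P`, then `Q` -/
  | seq (P Q : Program) : Program
  /-- if `reg a ≠ 0` then `P` else `Q` -/
  | branch (a : ℕ) (P Q : Program) : Program
  /-- while `reg a ≠ 0` do `P` -/
  | loop (a : ℕ) (P : Program) : Program

/-- A state of the machine: the contents of the registers and of the memory. -/
structure State : Type where
  /-- the registers -/
  reg : ℕ → ℕ
  /-- the memory cells, with their addresses -/
  mem : ℕ → ℕ

/-- The state after writing `x` into register `r`. -/
def State.setReg (s : State) (r x : ℕ) : State :=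
  { s with reg := Function.update s.reg r x }

/-- The state after writing `x` into the memory cell with address `a`. -/
def State.setMem (s : State) (a x : ℕ) : State :=
  { s with mem := Function.update s.mem a x }

/-- `Exec W P s t s'`: with words smaller than `W`, the program `P`, started in the state `s`,
halts after exactly `t` steps in the state `s'`. -/
inductive Exec (W : ℕ) : Program → State → ℕ → State → Prop
  | skip (s : State) : Exec W .skip s 1 s
  | const (s : State) (r c : ℕ) (hW : c < W) :
      Exec W (.const r c) s 1 (s.setReg r c)
  | op (s : State) (o : BinOp) (r a b : ℕ) (hW : o.eval (s.reg a) (s.reg b) < W) :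
      Exec W (.op o r a b) s 1 (s.setReg r (o.eval (s.reg a) (s.reg b)))
  | load (s : State) (r a : ℕ) :
      Exec W (.load r a) s 1 (s.setReg r (s.mem (s.reg a)))
  | store (s : State) (a b : ℕ) :
      Exec W (.store a b) s 1 (s.setMem (s.reg a) (s.reg b))
  | seq {P Q : Program} {s s' s'' : State} {t t' : ℕ}
      (hP : Exec W P s t s') (hQ : Exec W Q s' t' s'') :
      Exec W (.seq P Q) s (t + t') s''
  | branch_true {a : ℕ} {P Q : Program} {s s' : State} {t : ℕ}
      (ha : s.reg a ≠ 0) (hP : Exec W P s t s') :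
      Exec W (.branch a P Q) s (t + 1) s'
  | branch_false {a : ℕ} {P Q : Program} {s s' : State} {t : ℕ}
      (ha : s.reg a = 0) (hQ : Exec W Q s t s') :
      Exec W (.branch a P Q) s (t + 1) s'
  | loop_done {a : ℕ} {P : Program} {s : State} (ha : s.reg a = 0) :
      Exec W (.loop a P) s 1 s
  | loop_step {a : ℕ} {P : Program} {s s' s'' : State} {t t' : ℕ}
      (ha : s.reg a ≠ 0) (hP : Exec W P s t s') (hL : Exec W (.loop a P) s' t' s'') :
      Exec W (.loop a P) s (t + t' + 1) s''

open Classical in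
/-- The initial state on the instance `(G, k)`: register `0` holds the number `n` of vertices of
`G`, register `1` holds `k`, and the memory holds the adjacency matrix of `G` row by row (the entry
in row `i` and column `j` has address `i * n + j`); everything else is `0`. -/
noncomputable def input {n : ℕ} (G : SimpleGraph (Fin n)) (k : ℕ) : State where
  reg := fun r => if r = 0 then n else if r = 1 then k else 0
  mem := fun a => if ∃ i j : Fin n, a = i.val * n + j.val ∧ G.Adj i j then 1 else 0

open Classical in
/-- A decision problem `Q`, whose instances consist of a graph `G` on `n` vertices and a positive
integer `k`, can be decided in time `T n k`: a single program, with words of length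
`O(log (n + k))`, halts on every instance after at most `T n k` steps, with the answer
(`1` for yes, `0` for no) in register `0`. -/
def DecidableInTime (Q : (n : ℕ) → SimpleGraph (Fin n) → ℕ → Prop) (T : ℕ → ℕ → ℕ) : Prop :=
  ∃ (P : Program) (c : ℕ), ∀ (n k : ℕ), 1 ≤ k → ∀ G : SimpleGraph (Fin n),
    ∃ (t : ℕ) (s : State), Exec ((n + k + 2) ^ c) P (input G k) t s ∧ t ≤ T n k ∧
      s.reg 0 = if Q n G k then 1 else 0

/-- The class XP: one program decides all instances, in time `f k * (n + 1) ^ f k` for some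
computable function `f` of the parameter `k`. -/
def InXP (Q : (n : ℕ) → SimpleGraph (Fin n) → ℕ → Prop) : Prop :=
  ∃ f : ℕ → ℕ, Computable f ∧ DecidableInTime Q (fun n k => f k * (n + 1) ^ f k)

end WordRAM

/-- The decision problem: is the boxicity of the complement of the line graph of `G` at most `k`? -/
def CoLineBoxicityAtMost (n : ℕ) (G : SimpleGraph (Fin n)) (k : ℕ) : Prop :=
  boxicity (G.lineGraphᶜ) ≤ (k : ℕ∞)

/-! Non-adjacency in the complement of `L(G)` means that two edges of `G` are different and share an
endpoint: they cross (or are equal). Boxes are disjoint if and only if they are separated in some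
coordinate, and the separated pairs of one coordinate form an interval order. Hence the boxicity is
at most `k` if and only if `k` interval orders, all of whose comparable pairs cross, together cover
all crossing pairs.

Such an interval order is dominated by one with a short description. Let `e₁, e₂` have the smallest
right ends and `f₁, f₂` the largest left ends. If `g` lies before `h`, with `g` outside `{e₁, e₂}`
and `h` outside `{f₁, f₂}`, then each of `g, e₁, e₂` crosses each of `h, f₁, f₂`; this forces all
six edges through one vertex (`mem_of_crosses_three`). So the four extreme edges determine a
relation that contains the whole order (`exists_quad_of_intervals`). Conversely the relation of
every quadruple comes from a ranking of the edges (`QuadCovers.rank`), and rankings give boxes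
(`hasBoxRepresentation_compl_of_rank`). It remains to search for `k` quadruples.

By `star_or_four` the edges of a quadruple have a common vertex, so that five vertices describe it,
or live on four vertices. Reversing an order does not change what it covers, which halves the first
kind: about `n ^ 5 / 2` codes suffice (`exists_codeCovers`). The program runs through all `k`-tuples
of codes with a counter in base `N = numCodes n` and checks `n ^ 3` pairs against `k` codes, in time
`O(N ^ k * n ^ 3 * k)`. For large `n`, `N` is at most `3/4 * n ^ 5`, and `(3/4) ^ k * k` is bounded,
which absorbs the factor `k` (`exists_numCodes_pow_mul_le`). For `k ≥ n` the answer is always yes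
(`coLineBoxicityAtMost_of_le`), so small `n` leave only finitely many cases. -/

/-! ### Crossing edges: stars and four-vertex configurations -/

/-- Two different edges with a common endpoint. -/
def Crosses {V : Type*} (e f : Sym2 V) : Prop := e ≠ f ∧ ∃ v, v ∈ e ∧ v ∈ f

theorem crosses_mk {V : Type*} {a b c d : V} : Crosses s(a, b) s(c, d) ↔
    (a = c ∨ a = d ∨ b = c ∨ b = d) ∧ ¬ ((a = c ∧ b = d) ∨ (a = d ∧ b = c)) := by
  simp only [Crosses, Sym2.mem_iff, Sym2.eq_iff, ne_eq, and_comm (a := ¬ _), and_congr_left_iff]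
  refine fun _ => ⟨?_, ?_⟩
  · rintro ⟨v, rfl | rfl, h⟩ <;> tauto
  · rintro (rfl | rfl | rfl | rfl)
    exacts [⟨a, by simp⟩, ⟨a, by simp⟩, ⟨b, by simp⟩, ⟨b, by simp⟩]

/-- If the edges `g, e₁, e₂` cross the edges `h, f₁, f₂`, then the common endpoint of `g` and `h`
is an endpoint of `e₁`. -/
theorem mem_of_crosses_three {V : Type*} {g h e₁ e₂ f₁ f₂ : Sym2 V} {v : V} (hg : v ∈ g)
    (hh : v ∈ h) (dg : ¬ g.IsDiag) (dh : ¬ h.IsDiag) (de₁ : ¬ e₁.IsDiag) (de₂ : ¬ e₂.IsDiag)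
    (df₁ : ¬ f₁.IsDiag) (df₂ : ¬ f₂.IsDiag) (gh : Crosses g h) (e1 : e₁ ≠ g) (e2 : e₂ ≠ g)
    (e12 : e₁ ≠ e₂) (f1 : f₁ ≠ h) (f2 : f₂ ≠ h) (f12 : f₁ ≠ f₂) (h1 : Crosses e₁ h)
    (h2 : Crosses e₂ h) (h3 : Crosses g f₁) (h4 : Crosses g f₂) (h5 : Crosses e₁ f₁)
    (h6 : Crosses e₁ f₂) (h7 : Crosses e₂ f₁) (h8 : Crosses e₂ f₂) : v ∈ e₁ := by
  obtain ⟨a, rfl⟩ := hg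
  obtain ⟨b, rfl⟩ := hh
  by_contra hv
  -- With `g = va` and `h = vb`, an `e₁` that avoids `v` must meet `h` in `b`; write `e₁ = bc`.
  have hb : b ∈ e₁ := by
    obtain ⟨n1, w, hw, hw'⟩ := h1
    simp only [Sym2.mem_iff] at hw'; grind
  obtain ⟨c, rfl⟩ := hb
  simp only [Sym2.mem_iff, Sym2.mk_isDiag_iff, not_or] at hv dg dh de₁
  have hab : a ≠ b := by rintro rfl; simp [Crosses] at gh
  -- The candidates for `f₁` and `f₂`: the edges other than `vb` that cross both `va` and `bc`.
  have F : ∀ f : Sym2 V, ¬ f.IsDiag → f ≠ s(v, b) → Crosses s(v, a) f → Crosses s(b, c) f →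
      f = s(v, c) ∨ f = s(a, b) ∨ f = s(a, c) ∨ (a = c ∧ ∃ y, f = s(a, y) ∧ y ≠ v ∧ y ≠ b ∧ y ≠ a) := by
    intro f df hf k1 k2
    have hm : a ∈ f ∨ v ∈ f := by
      obtain ⟨-, w, hw, hw'⟩ := k1
      rcases Sym2.mem_iff.1 hw with rfl | rfl
      exacts [.inr hw', .inl hw']
    clear h3 h4 h5 h6 h7 h8 h2 e2 f1 f2 e12 f12
    obtain ⟨y, rfl⟩ | ⟨y, rfl⟩ := hm <;>
    simp only [crosses_mk, Sym2.eq_iff, ne_eq, Sym2.mk_isDiag_iff] at *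
    · by_cases hc : a = c
      · by_cases hy : y = v ∨ y = b
        · grind
        · right; right; right; exact ⟨hc, y, by grind⟩
      · grind
    · grind
  have E : (v ∈ e₂ ∧ a ∉ e₂) ∨ (b ∈ e₂ ∧ c ∉ e₂ ∧ v ∉ e₂) := by
    induction e₂ with | _ r s
    simp only [crosses_mk, Sym2.eq_iff, ne_eq, Sym2.mk_isDiag_iff, Sym2.mem_iff] at *
    clear F h3 h4 h5 h6 h7 h8
    grind
  have E' : (∃ y, e₂ = s(v, y) ∧ y ≠ v ∧ y ≠ a ∧ y ≠ b) ∨ ∃ y, e₂ = s(b, y) ∧ y ≠ b ∧ y ≠ c ∧ y ≠ v := by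
    clear F h3 h4 h5 h6 h7 h8
    rcases E with ⟨⟨y, rfl⟩, h⟩ | ⟨⟨y, rfl⟩, h⟩
    · left
      refine ⟨y, rfl, ?_⟩
      simp only [crosses_mk, Sym2.eq_iff, ne_eq, Sym2.mk_isDiag_iff, Sym2.mem_iff] at *
      grind
    · right
      refine ⟨y, rfl, ?_⟩
      simp only [crosses_mk, Sym2.eq_iff, ne_eq, Sym2.mk_isDiag_iff, Sym2.mem_iff] at *
      grind
  clear E
  have F1 := F f₁ df₁ f1 h3 h5
  have F2 := F f₂ df₂ f2 h4 h6
  clear F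
  obtain ⟨hv1, hv2⟩ := hv
  -- For either shape of `e₂`, at most one of the candidates crosses `e₂`, contrary to `f₁ ≠ f₂`.
  obtain ⟨y, rfl, hy⟩ | ⟨y, rfl, hy⟩ := E' <;>
  obtain rfl | rfl | rfl | ⟨rfl, z, rfl, hz⟩ := F1 <;>
  obtain rfl | rfl | rfl | ⟨h, w, rfl, hw⟩ := F2 <;>
  simp only [crosses_mk, Sym2.eq_iff, ne_eq, Sym2.mk_isDiag_iff] at * <;> grind

/-- If the edges `e₁, e₂` cross the edges `f₁, f₂`, then all four have a common endpoint, or they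
live on four vertices. -/
theorem star_or_four {V : Type*} {e₁ e₂ f₁ f₂ : Sym2 V} (h5 : Crosses e₁ f₁)
    (h6 : Crosses e₁ f₂) (h7 : Crosses e₂ f₁) (h8 : Crosses e₂ f₂) :
    (∃ v, v ∈ e₁ ∧ v ∈ e₂ ∧ v ∈ f₁ ∧ v ∈ f₂) ∨ ∃ p : Fin 4 → V,
      ∀ e ∈ ({e₁, e₂, f₁, f₂} : Set (Sym2 V)), ∃ i j, e = s(p i, p j) := by
  have key : (∃ v, v ∈ e₁ ∧ v ∈ e₂ ∧ v ∈ f₁ ∧ v ∈ f₂) ∨ ∃ a b c d, ∀ x, x ∈ e₁ ∨ x ∈ e₂ ∨ x ∈ f₁ ∨ x ∈ f₂ → x = a ∨ x = b ∨ x = c ∨ x = d := by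
    -- With `e₁ = ab` and `f₁ = ac`, the edge `e₂` has an endpoint in `{a, c}` and `f₂` one in `{a,
    -- b}`. Unless both pass through `a`, their crossing leaves room for only one vertex outside
    -- `{a, b, c}`.
    obtain ⟨n1, a, ⟨b, rfl⟩, ⟨c, rfl⟩⟩ := h5
    have A : ∃ s y, e₂ = s(s, y) ∧ (s = a ∨ s = c) := by
      obtain ⟨-, w, ⟨y, rfl⟩, hw⟩ := h7
      exact ⟨w, y, rfl, by simpa using hw⟩
    have B : ∃ s y, f₂ = s(s, y) ∧ (s = a ∨ s = b) := by
      obtain ⟨-, w, hw, ⟨y, rfl⟩⟩ := h6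
      exact ⟨w, y, rfl, by simpa using hw⟩
    obtain ⟨s, y, rfl, hs⟩ := A
    obtain ⟨r, z, rfl, hr⟩ := B
    simp only [crosses_mk, Sym2.mem_iff] at *
    by_cases s1 : s = a
    · by_cases s2 : r = a
      · left; exact ⟨a, by grind⟩
      · right
        by_cases y = a
        · exact ⟨a, b, c, z, by grind⟩
        by_cases y = b
        · exact ⟨a, b, c, z, by grind⟩
        · exact ⟨a, b, c, y, by grind⟩
    · right
      by_cases s2 : r = a
      · by_cases z = c
        · exact ⟨a, b, c, y, by grind⟩
        · by_cases z = s
          · exact ⟨a, b, c, y, by grind⟩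
          · exact ⟨a, b, c, z, by grind⟩
      · by_cases z = c
        · exact ⟨a, b, c, y, by grind⟩
        · exact ⟨a, b, c, z, by grind⟩
  obtain h | ⟨a, b, c, d, h⟩ := key
  · exact .inl h
  · refine .inr ⟨![a, b, c, d], fun e he => ?_⟩
    have P : ∀ x ∈ e, ∃ i, x = ![a, b, c, d] i := by
      intro x hx
      have : x = a ∨ x = b ∨ x = c ∨ x = d := h x (by
        simp only [Set.mem_insert_iff, Set.mem_singleton_iff] at he
        grind)
      rcases this with rfl | rfl | rfl | rfl
      exacts [⟨0, rfl⟩, ⟨1, rfl⟩, ⟨2, rfl⟩, ⟨3, rfl⟩]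
    induction e with | _ x y
    obtain ⟨i, hi⟩ := P x (Sym2.mem_mk_left _ _)
    obtain ⟨j, hj⟩ := P y (Sym2.mem_mk_right _ _)
    exact ⟨i, j, by rw [hi, hj]⟩

theorem Crosses.symm {V : Type*} {e f : Sym2 V} (h : Crosses e f) : Crosses f e :=
  ⟨h.1.symm, h.2.imp fun _ hv => hv.symm⟩

/-! ### Box representations and interval orders -/

theorem lineGraph_adj_iff_crosses {V : Type*} {G : SimpleGraph V} {e f : G.edgeSet} :
    G.lineGraph.Adj e f ↔ Crosses (e : Sym2 V) f := by
  rw [SimpleGraph.lineGraph_adj_iff_exists, Crosses, Ne, Ne, Subtype.ext_iff]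

theorem Icc_inter_Icc_nonempty_iff {d : ℕ} {a b a' b' : Fin d → ℝ} (h : a ≤ b) (h' : a' ≤ b') :
    (Set.Icc a b ∩ Set.Icc a' b').Nonempty ↔ ∀ i, a i ≤ b' i ∧ a' i ≤ b i := by
  rw [Set.Icc_inter_Icc, Set.nonempty_Icc, sup_le_iff, le_inf_iff, le_inf_iff]
  simp only [h, h', true_and, and_true, Pi.le_def, ← forall_and]

/-- If every edge of `L` is witnessed by one of `k` rankings of the vertices, then the complement
of `L` has a box representation of dimension `k`. -/
theorem hasBoxRepresentation_compl_of_rank {V : Type*} (L : SimpleGraph V) (k : ℕ)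
    (ρ : Fin k → V → ℕ)
    (hρ : ∀ e f, L.Adj e f → ∃ j, (∀ g, ρ j g ≤ ρ j e → L.Adj g f) ∨
      (∀ g, ρ j g ≤ ρ j f → L.Adj g e)) : HasBoxRepresentation Lᶜ k := by
  -- The interval of `v` runs from the least rank of a non-neighbour of `v` to the rank of `v`. It
  -- is non-empty because `v` is not its own neighbour, and `u` lies to its left exactly when
  -- everything ranked up to `u` is adjacent to `v`.
  have hne : ∀ v i, ∃ m, m ∈ {m | ∃ g, ¬ L.Adj g v ∧ ρ i g = m} := fun v i => ⟨_, v, L.irrefl, rfl⟩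
  have hle : ∀ v i, sInf {m | ∃ g, ¬ L.Adj g v ∧ ρ i g = m} ≤ ρ i v :=
    fun v i => Nat.sInf_le ⟨v, L.irrefl, rfl⟩
  have hlt : ∀ u v i, ρ i u < sInf {m | ∃ g, ¬ L.Adj g v ∧ ρ i g = m} ↔
      ∀ g, ρ i g ≤ ρ i u → L.Adj g v := by
    intro u v i
    constructor
    · intro h g hg
      by_contra hgv
      have : sInf {m | ∃ g, ¬ L.Adj g v ∧ ρ i g = m} ≤ ρ i g := Nat.sInf_le ⟨g, hgv, rfl⟩
      omega
    · intro h
      obtain ⟨g, hg, hm⟩ := Nat.sInf_mem (hne v i)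
      rw [← hm]
      by_contra hc
      exact hg (h g (by omega))
  refine ⟨fun v i => (sInf {m | ∃ g, ¬ L.Adj g v ∧ ρ i g = m} : ℕ), fun v i => ρ i v,
    fun v i => Nat.cast_le.2 (hle v i), fun u v huv => ?_⟩
  rw [Icc_inter_Icc_nonempty_iff (fun i => Nat.cast_le.2 (hle u i))
    (fun i => Nat.cast_le.2 (hle v i)), SimpleGraph.compl_adj]
  simp only [Nat.cast_le, huv, ne_eq, not_false_eq_true, true_and]
  rw [← not_iff_not, not_not]
  push Not
  constructor
  · intro h
    obtain ⟨j, hj | hj⟩ := hρ u v h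
    · refine ⟨j, fun _ => (hlt _ _ _).2 hj⟩
    · refine ⟨j, fun h => absurd h (not_le.2 ((hlt _ _ _).2 hj))⟩
  · rintro ⟨i, hi⟩
    by_cases h : sInf {m | ∃ g, ¬ L.Adj g u ∧ ρ i g = m} ≤ ρ i v
    · exact (hlt _ _ _).1 (hi h) u le_rfl
    · exact ((hlt _ _ _).1 (not_le.1 h) v le_rfl).symm

/-- Separation in one coordinate already makes boxes disjoint, and disjoint boxes are separated in
some coordinate. The case `u = v` is excluded by `lo ≤ hi`. -/
theorem HasBoxRepresentation.exists_intervals {V : Type*} {L : SimpleGraph V} {d : ℕ}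
    (h : HasBoxRepresentation Lᶜ d) : ∃ lo hi : Fin d → V → ℝ,
      (∀ i u v, hi i u < lo i v → L.Adj u v) ∧
      ∀ u v, L.Adj u v → ∃ i, hi i u < lo i v ∨ hi i v < lo i u := by
  obtain ⟨lo, hi, hle, h⟩ := h
  have key : ∀ u v, u ≠ v → (L.Adj u v ↔ ∃ i, hi u i < lo v i ∨ hi v i < lo u i) := by
    intro u v huv
    have := h u v huv
    rw [Icc_inter_Icc_nonempty_iff (hle u) (hle v), SimpleGraph.compl_adj] at this
    simp only [huv, ne_eq, not_false_eq_true, true_and] at this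
    rw [← not_iff_not, this]
    push Not
    exact forall_congr' fun i => and_comm
  refine ⟨fun i v => lo v i, fun i v => hi v i, fun i u v huv => ?_, fun u v huv =>
    (key u v huv.ne).1 huv⟩
  refine (key u v ?_).2 ⟨i, .inl huv⟩
  rintro rfl
  exact absurd huv (not_lt.2 (hle u i))

/-- Passing to `< k + 1` turns the bound on the infimum into a witness. -/
theorem boxicity_le_iff {V : Type*} (H : SimpleGraph V) (k : ℕ) :
    boxicity H ≤ k ↔ ∃ d ≤ k, HasBoxRepresentation H d := by
  rw [← Order.lt_add_one_iff_of_not_isMax (by simp), boxicity, iInf_lt_iff]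
  simp only [iInf_lt_iff, Set.mem_ofPred_eq, exists_prop]
  refine exists_congr fun d => ?_
  rw [and_comm, and_congr_left_iff]
  intro _
  norm_cast
  omega

/-! ### Quadruples and the pairs they cover -/

/-- The quadruples of edges that describe the maximal interval-order subgraphs of the line graph:
the first two and the last two edges of the order. -/
def IsQuad {V : Type*} (G : SimpleGraph V) (e₁ e₂ f₁ f₂ : Sym2 V) : Prop :=
  (e₁ ∈ G.edgeSet ∧ e₂ ∈ G.edgeSet ∧ f₁ ∈ G.edgeSet ∧ f₂ ∈ G.edgeSet) ∧
    Crosses e₁ f₁ ∧ Crosses e₁ f₂ ∧ Crosses e₂ f₁ ∧ Crosses e₂ f₂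

/-- The pairs `(g, h)` that a quadruple covers because `g` is one of its members. -/
def EndCovers {V : Type*} (e₁ e₂ f₁ f₂ g h : Sym2 V) : Prop :=
  g = e₁ ∨ g = f₁ ∨ (g = e₂ ∧ Crosses h e₁) ∨ (g = f₂ ∧ Crosses h f₁)

/-- The crossing pairs `(g, h)` that belong to the interval-order subgraph of a quadruple. -/
def QuadCovers {V : Type*} (G : SimpleGraph V) (e₁ e₂ f₁ f₂ g h : Sym2 V) : Prop :=
  IsQuad G e₁ e₂ f₁ f₂ ∧ (EndCovers e₁ e₂ f₁ f₂ g h ∨ EndCovers e₁ e₂ f₁ f₂ h g ∨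
    ∃ v, (v ∈ g ∧ v ∈ h) ∧ v ∈ e₁ ∧ v ∈ e₂ ∧ v ∈ f₁ ∧ v ∈ f₂)

/-- This symmetry lets the codes describe only half of the quadruples with a common vertex. -/
theorem QuadCovers.reverse {V : Type*} {G : SimpleGraph V} {e₁ e₂ f₁ f₂ g h : Sym2 V}
    (H : QuadCovers G e₁ e₂ f₁ f₂ g h) : QuadCovers G f₁ f₂ e₁ e₂ g h := by
  obtain ⟨⟨⟨a, b, c, d⟩, a', b', c', d'⟩, H⟩ := H
  refine ⟨⟨⟨c, d, a, b⟩, a'.symm, c'.symm, b'.symm, d'.symm⟩, ?_⟩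
  unfold EndCovers at *
  obtain H | H | ⟨v, H⟩ := H
  · left; tauto
  · right; left; tauto
  · right; right; exact ⟨v, by tauto⟩

/-! ### From a quadruple to a ranking -/

/-- The sum of the endpoints of an edge: it distinguishes the edges at a vertex. -/
def endpointSum {n : ℕ} : Sym2 (Fin n) → ℕ :=
  Sym2.lift ⟨fun a b => a.val + b.val, fun _ _ => Nat.add_comm _ _⟩

theorem endpointSum_le {n : ℕ} (e : Sym2 (Fin n)) : endpointSum e ≤ 2 * n := by
  induction e with | _ a b
  simp only [endpointSum, Sym2.lift_mk]
  omega

theorem endpointSum_ne {n : ℕ} {e f : Sym2 (Fin n)} {v : Fin n} (he : v ∈ e) (hf : v ∈ f)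
    (hef : e ≠ f) : endpointSum e ≠ endpointSum f := by
  obtain ⟨a, rfl⟩ := he
  obtain ⟨b, rfl⟩ := hf
  simp only [endpointSum, Sym2.lift_mk]
  intro h
  exact hef (by rw [show a = b from Fin.ext (by omega)])

/-- The edge `e` contains a vertex common to a quadruple, and is not one of its last two edges. -/
def InStar {V : Type*} (e₁ e₂ f₁ f₂ e : Sym2 V) : Prop :=
  (∃ v, v ∈ e ∧ v ∈ e₁ ∧ v ∈ e₂ ∧ v ∈ f₁ ∧ v ∈ f₂) ∧ e ≠ f₁ ∧ e ≠ f₂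

open Classical in
/-- The order of the edges in the interval-order subgraph of a quadruple. -/
noncomputable def quadRank {n : ℕ} (e₁ e₂ f₁ f₂ e : Sym2 (Fin n)) : ℕ :=
  if e = e₁ then 0 else if e = e₂ then 1 else if InStar e₁ e₂ f₁ f₂ e then 2 + endpointSum e
    else if Crosses e f₁ ∧ Crosses e f₂ then 2 * n + 3
    else if Crosses e f₁ then 2 * n + 4 else 2 * n + 5

section quadRank

variable {n : ℕ} {e₁ e₂ f₁ f₂ : Sym2 (Fin n)}

theorem InStar.crosses {e : Sym2 (Fin n)} (h : InStar e₁ e₂ f₁ f₂ e) :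
    Crosses e f₁ ∧ Crosses e f₂ := by
  obtain ⟨⟨v, hv⟩, h, h'⟩ := h
  exact ⟨⟨h, v, hv.1, hv.2.2.2.1⟩, ⟨h', v, hv.1, hv.2.2.2.2⟩⟩

theorem eq_of_quadRank_le_zero {e : Sym2 (Fin n)} (he : quadRank e₁ e₂ f₁ f₂ e ≤ 0) : e = e₁ := by
  unfold quadRank at he
  split_ifs at he <;> first | assumption | omega

theorem eq_of_quadRank_le_one {e : Sym2 (Fin n)} (he : quadRank e₁ e₂ f₁ f₂ e ≤ 1) :
    e = e₁ ∨ e = e₂ := by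
  unfold quadRank at he
  split_ifs at he with h₁ h₂ <;> first | exact .inl h₁ | exact .inr h₂ | omega

theorem of_quadRank_le {e : Sym2 (Fin n)} (he : quadRank e₁ e₂ f₁ f₂ e ≤ 2 * n + 2) :
    e = e₁ ∨ e = e₂ ∨ (InStar e₁ e₂ f₁ f₂ e ∧ quadRank e₁ e₂ f₁ f₂ e = 2 + endpointSum e) := by
  unfold quadRank at he ⊢
  split_ifs at he ⊢ with h₁ h₂ h₃ <;>
    first | exact .inl h₁ | exact .inr (.inl h₂) | exact .inr (.inr ⟨h₃, rfl⟩) | omega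

/-- The edges `e₁`, `e₂` and the star edges come first, and all of them cross `f₁` and `f₂`; star
ranks stay below `2 * n + 3` by `endpointSum_le`. -/
theorem quadRank_le_iff₂ (h₁ : Crosses e₁ f₁) (h₂ : Crosses e₁ f₂) (h₃ : Crosses e₂ f₁)
    (h₄ : Crosses e₂ f₂) (e : Sym2 (Fin n)) :
    quadRank e₁ e₂ f₁ f₂ e ≤ 2 * n + 3 ↔ Crosses e f₁ ∧ Crosses e f₂ := by
  have := endpointSum_le e
  unfold quadRank
  split_ifs with a b c d d'
  · subst a; simp [h₁, h₂]
  · subst b; simp [h₃, h₄]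
  · simp only [c.crosses, and_self, iff_true]; omega
  all_goals simp [d]

theorem quadRank_le_iff₁ (h₁ : Crosses e₁ f₁) (h₃ : Crosses e₂ f₁) (e : Sym2 (Fin n)) :
    quadRank e₁ e₂ f₁ f₂ e ≤ 2 * n + 4 ↔ Crosses e f₁ := by
  have := endpointSum_le e
  unfold quadRank
  split_ifs with a b c d d'
  · subst a; simp [h₁]
  · subst b; simp [h₃]
  · simp only [c.crosses, iff_true]; omega
  · simp [d]
  all_goals simp [d']

/-- The initial segments at `e₁` and `e₂` lie in `{e₁}` and `{e₁, e₂}`. Pairs with `f₁` or `f₂` use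
the other edge's initial segment, which consists of edges crossing `f₁`, respectively both `f₁` and
`f₂`. -/
theorem EndCovers.rank {g h : Sym2 (Fin n)} (h₁ : Crosses e₁ f₁) (h₂ : Crosses e₁ f₂)
    (h₃ : Crosses e₂ f₁) (h₄ : Crosses e₂ f₂) (gh : Crosses g h)
    (H : EndCovers e₁ e₂ f₁ f₂ g h) :
    (∀ g', quadRank e₁ e₂ f₁ f₂ g' ≤ quadRank e₁ e₂ f₁ f₂ g → Crosses g' h) ∨
      ∀ g', quadRank e₁ e₂ f₁ f₂ g' ≤ quadRank e₁ e₂ f₁ f₂ h → Crosses g' g := by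
  obtain rfl | rfl | ⟨rfl, hx⟩ | ⟨rfl, hx⟩ := H
  · left
    intro g' hg'
    rwa [eq_of_quadRank_le_zero (hg'.trans (by simp [quadRank]))]
  · right
    intro g' hg'
    exact (quadRank_le_iff₁ h₁ h₃ g').1 (hg'.trans ((quadRank_le_iff₁ h₁ h₃ h).2 gh.symm))
  · left
    intro g' hg'
    obtain rfl | rfl := eq_of_quadRank_le_one
      (hg'.trans (by unfold quadRank; split_ifs <;> simp_all))
    exacts [hx.symm, gh]
  · right
    intro g' hg'
    exact ((quadRank_le_iff₂ h₁ h₂ h₃ h₄ g').1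
      (hg'.trans ((quadRank_le_iff₂ h₁ h₂ h₃ h₄ h).2 ⟨hx, gh.symm⟩))).2

/-- The segment up to `g` contains only edges through `v`; `h` is not among them, since edges at `v`
have different endpoint sums. -/
theorem InStar.rank {g h : Sym2 (Fin n)} {v : Fin n} (h₁ : Crosses e₁ f₁)
    (hv : (v ∈ g ∧ v ∈ h) ∧ v ∈ e₁ ∧ v ∈ e₂ ∧ v ∈ f₁ ∧ v ∈ f₂) (gh : g ≠ h)
    (g₁ : g ≠ e₁) (g₂ : g ≠ e₂) (k₁ : h ≠ e₁) (k₂ : h ≠ e₂) (Sg : InStar e₁ e₂ f₁ f₂ g)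
    (Sh : InStar e₁ e₂ f₁ f₂ h) (hle : quadRank e₁ e₂ f₁ f₂ g ≤ quadRank e₁ e₂ f₁ f₂ h) :
    ∀ g', quadRank e₁ e₂ f₁ f₂ g' ≤ quadRank e₁ e₂ f₁ f₂ g → Crosses g' h := by
  intro g' hg'
  obtain ⟨⟨vg, vh⟩, v₁, v₂, v₃, v₄⟩ := hv
  have rg : quadRank e₁ e₂ f₁ f₂ g = 2 + endpointSum g := by simp [quadRank, g₁, g₂, Sg]
  have rh : quadRank e₁ e₂ f₁ f₂ h = 2 + endpointSum h := by simp [quadRank, k₁, k₂, Sh]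
  have := endpointSum_ne vg vh gh
  have := endpointSum_le g
  obtain rfl | rfl | ⟨⟨⟨w, hw⟩, -⟩, hr⟩ := of_quadRank_le (hg'.trans (by omega))
  · exact ⟨k₁.symm, v, v₁, vh⟩
  · exact ⟨k₂.symm, v, v₂, vh⟩
  · have hne : g' ≠ h := by rintro rfl; omega
    -- Two common vertices would make `e₁` and `f₁` equal.
    obtain rfl : w = v := by
      by_contra hwv
      exact h₁.1 (((Sym2.mem_and_mem_iff hwv).1 ⟨hw.2.1, v₁⟩).trans
        ((Sym2.mem_and_mem_iff hwv).1 ⟨hw.2.2.2.1, v₃⟩).symm)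
    exact ⟨hne, w, hw.1, vh⟩

theorem endCovers_or_inStar {g h : Sym2 (Fin n)} {v : Fin n} (_ : g ≠ h)
    (hv : (v ∈ g ∧ v ∈ h) ∧ v ∈ e₁ ∧ v ∈ e₂ ∧ v ∈ f₁ ∧ v ∈ f₂) :
    EndCovers e₁ e₂ f₁ f₂ g h ∨ EndCovers e₁ e₂ f₁ f₂ h g ∨
      (g ≠ e₁ ∧ g ≠ e₂ ∧ InStar e₁ e₂ f₁ f₂ g) := by
  obtain ⟨⟨vg, vh⟩, v₁, v₂, v₃, v₄⟩ := hv
  by_cases g₁ : g = e₁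
  · exact .inl (.inl g₁)
  by_cases h₁ : h = e₁
  · exact .inr (.inl (.inl h₁))
  by_cases g₂ : g = e₂
  · exact .inl (.inr (.inr (.inl ⟨g₂, h₁, v, vh, v₁⟩)))
  by_cases g₃ : g = f₁
  · exact .inl (.inr (.inl g₃))
  by_cases h₃ : h = f₁
  · exact .inr (.inl (.inr (.inl h₃)))
  by_cases g₄ : g = f₂
  · exact .inl (.inr (.inr (.inr ⟨g₄, h₃, v, vh, v₃⟩)))
  exact .inr (.inr ⟨g₁, g₂, ⟨v, vg, v₁, v₂, v₃, v₄⟩, g₃, g₄⟩)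

end quadRank

/-- A pair not settled by one of the four end edges consists of two star edges; the one of lower
rank supplies the initial segment. -/
theorem QuadCovers.rank {n : ℕ} {G : SimpleGraph (Fin n)} {e₁ e₂ f₁ f₂ g h : Sym2 (Fin n)}
    (gh : Crosses g h) (H : QuadCovers G e₁ e₂ f₁ f₂ g h) :
    (∀ g', quadRank e₁ e₂ f₁ f₂ g' ≤ quadRank e₁ e₂ f₁ f₂ g → Crosses g' h) ∨
      ∀ g', quadRank e₁ e₂ f₁ f₂ g' ≤ quadRank e₁ e₂ f₁ f₂ h → Crosses g' g := by
  obtain ⟨⟨-, h₁, h₂, h₃, h₄⟩, H⟩ := H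
  have A : EndCovers e₁ e₂ f₁ f₂ g h → _ := fun H => H.rank h₁ h₂ h₃ h₄ gh
  have B : EndCovers e₁ e₂ f₁ f₂ h g → _ := fun H => (H.rank h₁ h₂ h₃ h₄ gh.symm).symm
  obtain H | H | ⟨v, hv⟩ := H
  · exact A H
  · exact B H
  obtain H | H | ⟨g₁, g₂, Sg⟩ := endCovers_or_inStar gh.1 hv
  · exact A H
  · exact B H
  have hv' := And.imp_left And.symm hv
  obtain H | H | ⟨k₁, k₂, Sh⟩ := endCovers_or_inStar gh.1.symm hv'
  · exact B H
  · exact A H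
  obtain hle | hle := le_total (quadRank e₁ e₂ f₁ f₂ g) (quadRank e₁ e₂ f₁ f₂ h)
  · exact .inl (InStar.rank h₁ hv gh.1 g₁ g₂ k₁ k₂ Sg Sh hle)
  · exact .inr (InStar.rank h₁ hv' gh.1.symm k₁ k₂ g₁ g₂ Sh Sg hle)

/-! ### From intervals to a quadruple -/

theorem not_isDiag_of_mem {V : Type*} {G : SimpleGraph V} (e : G.edgeSet) :
    ¬ (e : Sym2 V).IsDiag := G.not_isDiag_of_mem_edgeSet e.2

/-- A family of intervals whose disjoint pairs are crossing edges is dominated by a quadruple. -/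
theorem exists_quad_of_intervals {V : Type*} [Finite V] (G : SimpleGraph V)
    (lo hi : G.edgeSet → ℝ) (H : ∀ g h, hi g < lo h → Crosses (g : Sym2 V) h)
    {g₀ h₀ : G.edgeSet} (h₀₀ : hi g₀ < lo h₀) :
    ∃ e₁ e₂ f₁ f₂ : Sym2 V, IsQuad G e₁ e₂ f₁ f₂ ∧
      ∀ g h, hi g < lo h → QuadCovers G e₁ e₂ f₁ f₂ g h := by
  obtain ⟨e₁, -, he₁⟩ := Set.exists_min_image Set.univ hi Set.finite_univ ⟨g₀, trivial⟩
  obtain ⟨f₁, -, hf₁⟩ := Set.exists_max_image Set.univ lo Set.finite_univ ⟨g₀, trivial⟩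
  simp only [Set.mem_univ, true_implies] at he₁ hf₁
  -- A separated pair avoiding `e₁` and `f₁` guarantees that the second extremal edges exist and are
  -- themselves separated.
  by_cases hex : ∃ g h, hi g < lo h ∧ g ≠ e₁ ∧ h ≠ f₁
  · obtain ⟨g₁, h₁, hgh₁, hg₁, hh₁⟩ := hex
    obtain ⟨e₂, hne, he₂⟩ := Set.exists_min_image {e | e ≠ e₁} hi (Set.toFinite _) ⟨g₁, hg₁⟩
    obtain ⟨f₂, hnf, hf₂⟩ := Set.exists_max_image {f | f ≠ f₁} lo (Set.toFinite _) ⟨h₁, hh₁⟩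
    simp only [Set.mem_ofPred_eq] at hne hnf he₂ hf₂
    have l22 : hi e₂ < lo f₂ := (he₂ _ hg₁).trans_lt (hgh₁.trans_le (hf₂ _ hh₁))
    have l12 : hi e₁ < lo f₂ := (he₁ _).trans_lt l22
    have l21 : hi e₂ < lo f₁ := l22.trans_le (hf₁ _)
    have l11 : hi e₁ < lo f₁ := l12.trans_le (hf₁ _)
    have Q : IsQuad G (e₁ : Sym2 V) e₂ f₁ f₂ :=
      ⟨⟨e₁.2, e₂.2, f₁.2, f₂.2⟩, H _ _ l11, H _ _ l12, H _ _ l21, H _ _ l22⟩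
    refine ⟨e₁, e₂, f₁, f₂, Q, fun g h hgh => ⟨Q, ?_⟩⟩
    by_cases g1 : g = e₁
    · exact .inl (.inl (by rw [g1]))
    by_cases h1 : h = f₁
    · exact .inr (.inl (.inr (.inl (by rw [h1]))))
    have lh1 : hi e₁ < lo h := (he₁ g).trans_lt hgh
    have lh2 : hi e₂ < lo h := (he₂ g g1).trans_lt hgh
    have lg1 : hi g < lo f₁ := hgh.trans_le (hf₁ h)
    have lg2 : hi g < lo f₂ := hgh.trans_le (hf₂ h h1)
    by_cases g2 : g = e₂
    · exact .inl (.inr (.inr (.inl ⟨by rw [g2], (H _ _ lh1).symm⟩)))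
    by_cases h2 : h = f₂
    · exact .inr (.inl (.inr (.inr (.inr ⟨by rw [h2], H _ _ lg1⟩))))
    -- Now `g, e₁, e₂` all cross `h, f₁, f₂`; permuting the roles in `mem_of_crosses_three` puts `v`
    -- on each end edge.
    obtain ⟨v, vg, vh⟩ := (H _ _ hgh).2
    have N : ∀ {a b : G.edgeSet}, a ≠ b → (a : Sym2 V) ≠ b := fun h => Subtype.coe_ne_coe.2 h
    have D := @not_isDiag_of_mem V G
    refine .inr (.inr ⟨v, ⟨vg, vh⟩, ?_, ?_, ?_, ?_⟩)
    · exact mem_of_crosses_three vg vh (D g) (D h) (D e₁) (D e₂) (D f₁) (D f₂) (H _ _ hgh) (N (Ne.symm g1))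
        (N (Ne.symm g2)) (N hne.symm) (N (Ne.symm h1)) (N (Ne.symm h2)) (N hnf.symm)
        (H _ _ lh1) (H _ _ lh2) (H _ _ lg1) (H _ _ lg2) (H _ _ l11) (H _ _ l12) (H _ _ l21)
        (H _ _ l22)
    · exact mem_of_crosses_three vg vh (D g) (D h) (D e₂) (D e₁) (D f₁) (D f₂) (H _ _ hgh) (N (Ne.symm g2))
        (N (Ne.symm g1)) (N hne) (N (Ne.symm h1)) (N (Ne.symm h2)) (N hnf.symm)
        (H _ _ lh2) (H _ _ lh1) (H _ _ lg1) (H _ _ lg2) (H _ _ l21) (H _ _ l22) (H _ _ l11)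
        (H _ _ l12)
    · exact mem_of_crosses_three vh vg (D h) (D g) (D f₁) (D f₂) (D e₁) (D e₂) (H _ _ hgh).symm (N (Ne.symm h1))
        (N (Ne.symm h2)) (N hnf.symm) (N (Ne.symm g1)) (N (Ne.symm g2)) (N hne.symm)
        (H _ _ lg1).symm (H _ _ lg2).symm (H _ _ lh1).symm (H _ _ lh2).symm (H _ _ l11).symm
        (H _ _ l21).symm (H _ _ l12).symm (H _ _ l22).symm
    · exact mem_of_crosses_three vh vg (D h) (D g) (D f₂) (D f₁) (D e₁) (D e₂) (H _ _ hgh).symm (N (Ne.symm h2))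
        (N (Ne.symm h1)) (N hnf) (N (Ne.symm g1)) (N (Ne.symm g2)) (N hne.symm)
        (H _ _ lg2).symm (H _ _ lg1).symm (H _ _ lh1).symm (H _ _ lh2).symm (H _ _ l12).symm
        (H _ _ l22).symm (H _ _ l11).symm (H _ _ l21).symm
  -- Every separated pair starts with `e₁` or ends with `f₁`, so the degenerate quadruple with
  -- repeated edges suffices.
  · push Not at hex
    have l11 : hi e₁ < lo f₁ := (he₁ g₀).trans_lt (h₀₀.trans_le (hf₁ h₀))
    have Q : IsQuad G (e₁ : Sym2 V) e₁ f₁ f₁ :=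
      ⟨⟨e₁.2, e₁.2, f₁.2, f₁.2⟩, H _ _ l11, H _ _ l11, H _ _ l11, H _ _ l11⟩
    refine ⟨e₁, e₁, f₁, f₁, Q, fun g h hgh => ⟨Q, ?_⟩⟩
    by_cases g1 : g = e₁
    · exact .inl (.inl (by rw [g1]))
    · exact .inr (.inl (.inr (.inl (by rw [hex g h hgh g1]))))

/-! ### Codes of quadruples -/

section codes

variable {n : ℕ} [NeZero n]

/-- The four base vertices of a code. -/
def codeBase (n : ℕ) [NeZero n] (d : ℕ) (i : ℕ) : Fin n :=
  if i = 0 then Fin.ofNat n d else if i = 1 then Fin.ofNat n (d / n)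
    else if i = 2 then Fin.ofNat n (d / n / n) else Fin.ofNat n (d / n / n / n)

/-- The part of a code after the base vertices. -/
def codeRest (n d : ℕ) : ℕ := d / n / n / n / n

/-- The fifth vertex of the code of a quadruple of edges with a common vertex. -/
def codeFifth (n : ℕ) [NeZero n] (d : ℕ) : Fin n :=
  Fin.ofNat n (d / n % n + 1 + codeRest n d)

/-- The edge number `i` of a code: the edge from the first base vertex to `x` if the code describes
edges with a common vertex, otherwise an edge given by the digits of the rest. -/
def codeEdge (n : ℕ) [NeZero n] (d : ℕ) (i : ℕ) (x : Fin n) : Sym2 (Fin n) :=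
  if codeRest n d < n / 2 then s(codeBase n d 0, x) else
    s(codeBase n d ((codeRest n d - n / 2) / 4 ^ (2 * i) % 4),
      codeBase n d ((codeRest n d - n / 2) / 4 ^ (2 * i + 1) % 4))

/-- The pairs of edges covered by the quadruple with code `d`. -/
def CodeCovers (G : SimpleGraph (Fin n)) (d : ℕ) (g h : Sym2 (Fin n)) : Prop :=
  QuadCovers G (codeEdge n d 0 (codeBase n d 1)) (codeEdge n d 1 (codeBase n d 2))
    (codeEdge n d 2 (codeFifth n d)) (codeEdge n d 3 (codeBase n d 3)) g h

/-- The number of codes. -/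
def numCodes (n : ℕ) : ℕ := n * n * n * n * (n / 2 + 65536)

/-- Mixed radix: four digits in base `n`, followed by the unrestricted leading part `t`. -/
theorem exists_code (p : Fin 4 → Fin n) (t : ℕ) (ht : t < n / 2 + 65536) :
    ∃ d < numCodes n, codeRest n d = t ∧ ∀ i : Fin 4, codeBase n d i = p i := by
  have hn : 0 < n := NeZero.pos n
  have hd : ∀ (a : Fin n) x, (a + n * x) / n = x := fun a x => by
    rw [Nat.add_mul_div_left _ _ hn, Nat.div_eq_of_lt a.2, zero_add]
  have hm : ∀ (a : Fin n) x, Fin.ofNat n (a + n * x) = a := fun a x => by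
    ext; simp [Nat.mod_eq_of_lt a.2]
  refine ⟨p 0 + n * (p 1 + n * (p 2 + n * (p 3 + n * t))), ?_, ?_, ?_⟩
  · have hl : ∀ (a : Fin n) x y, x < y → a + n * x < n * y := fun a x y h => by
      have := a.2; nlinarith
    rw [numCodes, show n * n * n * n * (n / 2 + 65536) = n * (n * (n * (n * (n / 2 + 65536)))) by ring]
    exact hl _ _ _ (hl _ _ _ (hl _ _ _ (hl _ _ _ ht)))
  · simp only [codeRest, hd]
  · intro i
    fin_cases i <;> simp [codeBase, hd, hm, -Fin.ofNat_eq_cast]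

theorem exists_base_four_digits (s : Fin 8 → Fin 4) :
    ∃ t : ℕ, t < 65536 ∧ ∀ i : Fin 8, t / 4 ^ i.val % 4 = s i := by
  refine ⟨finFunctionFinEquiv s, (finFunctionFinEquiv s).2.trans_eq (by norm_num), fun i => ?_⟩
  have := congrArg Fin.val (congrFun (finFunctionFinEquiv.symm_apply_apply s) i)
  simpa [finFunctionFinEquiv] using this

/-- Every quadruple has a code, up to reversal. -/
theorem exists_codeCovers (G : SimpleGraph (Fin n)) {e₁ e₂ f₁ f₂ : Sym2 (Fin n)}
    (Q : IsQuad G e₁ e₂ f₁ f₂) : ∃ d < numCodes n, ∀ g h, QuadCovers G e₁ e₂ f₁ f₂ g h →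
      CodeCovers G d g h := by
  obtain ⟨v, ⟨u, rfl⟩, ⟨w, rfl⟩, ⟨x, rfl⟩, ⟨y, rfl⟩⟩ | ⟨p, hp⟩ :=
    star_or_four Q.2.1 Q.2.2.1 Q.2.2.2.1 Q.2.2.2.2
  · have key : ∀ u w x y : Fin n, ∀ t < n / 2, (u.val + 1 + t) % n = x →
        ∃ d < numCodes n, ∀ g h, QuadCovers G s(v, u) s(v, w) s(v, x) s(v, y) g h →
          CodeCovers G d g h := by
      intro u w x y t ht hx
      obtain ⟨d, hd, hr, hb⟩ := exists_code ![v, u, w, y] t (by omega)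
      refine ⟨d, hd, fun g h H => ?_⟩
      have b0 := hb 0
      have b1 := hb 1
      have b2 := hb 2
      have b3 := hb 3
      have b1' := congrArg Fin.val b1
      simp at b0 b1 b2 b3
      simp [codeBase] at b1'
      have b4 : codeFifth n d = x := by
        ext; simp [codeFifth, hr, b1', hx]
      simpa only [CodeCovers, codeEdge, hr, ht, if_true, b0, b1, b2, b3, b4] using H
    have hux : u.val ≠ x.val := fun h => Q.2.1.1 (by rw [Fin.ext h])
    have hu := u.2
    have hx := x.2
    -- On the cycle of length `n`, the offsets from `u` to `x` and from `x` to `u`, each lowered by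
    -- one, add up to `n - 2`; so one of them is less than `n / 2`. If it is the second, the
    -- quadruple is reversed.
    have hsplit : (∃ t < n / 2, (u.val + 1 + t) % n = x) ∨ ∃ t < n / 2, (x.val + 1 + t) % n = u := by
      have mod : ∀ a b c : ℕ, c < n → (a = c ∨ a = n + c) → a % n = c := by
        rintro a b c hc (rfl | rfl)
        · exact Nat.mod_eq_of_lt hc
        · simp [Nat.mod_eq_of_lt hc]
      rcases lt_or_gt_of_ne hux with h | h
      · by_cases h2 : x.val - u.val - 1 < n / 2
        · exact .inl ⟨_, h2, mod _ 0 _ hx (by omega)⟩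
        · exact .inr ⟨n + u - x - 1, by omega, mod _ 0 _ hu (by omega)⟩
      · by_cases h2 : u.val - x.val - 1 < n / 2
        · exact .inr ⟨_, h2, mod _ 0 _ hu (by omega)⟩
        · exact .inl ⟨n + x - u - 1, by omega, mod _ 0 _ hx (by omega)⟩
    obtain ⟨t, ht, h⟩ | ⟨t, ht, h⟩ := hsplit
    · exact key u w x y t ht h
    · obtain ⟨d, hd, H⟩ := key x y u w t ht h
      exact ⟨d, hd, fun g h H' => H g h H'.reverse⟩
  · obtain ⟨i₀, i₁, h₀⟩ := hp e₁ (by simp)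
    obtain ⟨i₂, i₃, h₂⟩ := hp e₂ (by simp)
    obtain ⟨i₄, i₅, h₄⟩ := hp f₁ (by simp)
    obtain ⟨i₆, i₇, h₆⟩ := hp f₂ (by simp)
    -- Four edges on four vertices need eight indices below four, hence `4 ^ 8 = 65536` values,
    -- placed after the `n / 2` star offsets.
    obtain ⟨t, ht, hs⟩ := exists_base_four_digits ![i₀, i₁, i₂, i₃, i₄, i₅, i₆, i₇]
    obtain ⟨d, hd, hr, hb⟩ := exists_code p (n / 2 + t) (by omega)
    refine ⟨d, hd, fun g h H => ?_⟩
    have E : ∀ (i : ℕ) x (j j' : Fin 4), t / 4 ^ (2 * i) % 4 = j → t / 4 ^ (2 * i + 1) % 4 = j' →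
        codeEdge n d i x = s(p j, p j') := by
      intro i x j j' h h'
      rw [codeEdge, hr, if_neg (by omega), Nat.add_sub_cancel_left, h, h', hb, hb]
    rw [CodeCovers, E 0 _ i₀ i₁ (hs 0) (hs 1), E 1 _ i₂ i₃ (hs 2) (hs 3),
      E 2 _ i₄ i₅ (hs 4) (hs 5), E 3 _ i₆ i₇ (hs 6) (hs 7), ← h₀, ← h₂, ← h₄, ← h₆]
    exact H

/-- The codes `D` cover all pairs of crossing edges. -/
def CodesCover (G : SimpleGraph (Fin n)) (k : ℕ) (D : ℕ → ℕ) : Prop :=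
  ∀ c a b : Fin n, G.Adj c a → G.Adj c b → a ≠ b → ∃ j < k, CodeCovers G (D j) s(c, a) s(c, b)

/-- Coordinates become codes through dominating quadruples, and codes become coordinates through
`quadRank`. Codes of non-quadruples do no harm: they cover nothing. -/
theorem coLineBoxicityAtMost_iff (G : SimpleGraph (Fin n)) (k : ℕ) :
    CoLineBoxicityAtMost n G k ↔ ∃ D : ℕ → ℕ, (∀ j < k, D j < numCodes n) ∧ CodesCover G k D := by
  have hN : 0 < numCodes n := by have := NeZero.pos n; unfold numCodes; positivity
  rw [CoLineBoxicityAtMost, boxicity_le_iff]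
  constructor
  · rintro ⟨d, hd, h⟩
    obtain ⟨lo, hi, h₁, h₂⟩ := h.exists_intervals
    have : ∀ i : Fin d, ∃ c < numCodes n, ∀ g h : G.edgeSet, hi i g < lo i h →
        CodeCovers G c g h := by
      intro i
      by_cases hex : ∃ g h, hi i g < lo i h
      · obtain ⟨g, h, hgh⟩ := hex
        obtain ⟨e₁, e₂, f₁, f₂, Q, hQ⟩ := exists_quad_of_intervals G (lo i) (hi i)
          (fun g h H => lineGraph_adj_iff_crosses.1 (h₁ i g h H)) hgh
        obtain ⟨c, hc, H⟩ := exists_codeCovers G Q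
        exact ⟨c, hc, fun g h H' => H _ _ (hQ g h H')⟩
      · push Not at hex
        -- A coordinate that separates nothing may receive any code.
        exact ⟨0, hN, fun g h H => absurd H (not_lt.2 (hex g h))⟩
    choose D hD hD' using this
    refine ⟨fun j => if hj : j < d then D ⟨j, hj⟩ else 0, fun j _ => ?_, ?_⟩
    · dsimp only
      split_ifs
      exacts [hD _, hN]
    · intro c a b ha hb hab
      obtain ⟨i, hi⟩ := h₂ ⟨s(c, a), ha⟩ ⟨s(c, b), hb⟩ (lineGraph_adj_iff_crosses.2
        ⟨by simpa [Sym2.eq_iff] using ⟨hab, by rintro rfl rfl; exact hab rfl⟩, c, by simp, by simp⟩)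
      refine ⟨i, by omega, ?_⟩
      simp only [i.2, dif_pos]
      obtain hi | hi := hi
      · exact hD' i _ _ hi
      · obtain ⟨Q, H⟩ := hD' i _ _ hi
        refine ⟨Q, ?_⟩
        obtain H | H | ⟨v, H⟩ := H
        · exact .inr (.inl H)
        · exact .inl H
        · exact .inr (.inr ⟨v, And.imp_left And.symm H⟩)
  · rintro ⟨D, -, hD⟩
    refine ⟨k, le_rfl, hasBoxRepresentation_compl_of_rank _ k (fun j e => quadRank
      (codeEdge n (D j) 0 (codeBase n (D j) 1)) (codeEdge n (D j) 1 (codeBase n (D j) 2))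
      (codeEdge n (D j) 2 (codeFifth n (D j))) (codeEdge n (D j) 3 (codeBase n (D j) 3)) e.1) ?_⟩
    rintro ⟨e, he⟩ ⟨f, hf⟩ hef
    rw [lineGraph_adj_iff_crosses] at hef
    have hef' := hef
    obtain ⟨hne, c, ⟨a, rfl⟩, ⟨b, rfl⟩⟩ := hef'
    obtain ⟨j, hj, H⟩ := hD c a b he hf (by rintro rfl; exact hne rfl)
    refine ⟨⟨j, hj⟩, (H.rank hef).imp ?_ ?_⟩ <;>
    · intro H g hg
      exact lineGraph_adj_iff_crosses.2 (H g hg)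

end codes

/-- One ranking per vertex `v` suffices: the edges at `v` come first, ordered injectively, and all
others after them, so it witnesses every pair crossing at `v`. -/
theorem coLineBoxicityAtMost_of_le (n k : ℕ) (G : SimpleGraph (Fin n)) (h : n ≤ k) :
    CoLineBoxicityAtMost n G k := by
  classical
  rw [CoLineBoxicityAtMost, boxicity_le_iff]
  refine ⟨n, h, hasBoxRepresentation_compl_of_rank _ n
    (fun v e => if v ∈ e.1 then endpointSum e.1 else 2 * n + 1) ?_⟩
  have key : ∀ v, ∀ e f : G.edgeSet, v ∈ e.1 → v ∈ f.1 → e.1 ≠ f.1 →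
      endpointSum e.1 ≤ endpointSum f.1 → ∀ g : G.edgeSet,
      (if v ∈ g.1 then endpointSum g.1 else 2 * n + 1) ≤ endpointSum e.1 → Crosses g.1 f.1 := by
    intro v e f ve vf hne hle g hg
    have := endpointSum_le e.1
    have := endpointSum_ne ve vf hne
    split_ifs at hg with vg
    · refine ⟨fun h => ?_, v, vg, vf⟩
      rw [h] at hg
      omega
    · omega
  intro e f hef
  rw [lineGraph_adj_iff_crosses] at hef
  obtain ⟨hne, v, ve, vf⟩ := hef
  refine ⟨v, ?_⟩
  simp only [ve, vf, if_true, lineGraph_adj_iff_crosses]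
  exact (le_total (endpointSum e.1) (endpointSum f.1)).imp (key v e f ve vf hne)
    (key v f e vf ve hne.symm)

/-! ### Compilation of arithmetic expressions -/

namespace WordRAM

/-- Arithmetic expressions over the first `T` registers and the memory. -/
inductive Expr (T : ℕ) : Type
  | reg (r : Fin T) : Expr T
  | const (c : ℕ) : Expr T
  | op (o : BinOp) (a b : Expr T) : Expr T
  | load (a : Expr T) : Expr T

namespace Expr

variable {T : ℕ}

/-- The value of an expression, for the contents `l` of the registers and `m` of the memory. -/
def eval (l : List ℕ) (m : ℕ → ℕ) : Expr T → ℕ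
  | reg r => l.getD r 0
  | const c => c
  | op o a b => o.eval (a.eval l m) (b.eval l m)
  | load a => m (a.eval l m)

/-- A program that computes an expression into the register `t`, using the registers from `t`. -/
def compile : Expr T → ℕ → Program
  | reg r, t => .seq (.const t 0) (.op .add t t r)
  | const c, t => .const t c
  | op o a b, t => .seq (a.compile t) (.seq (b.compile (t + 1)) (.op o t t (t + 1)))
  | load a, t => .seq (a.compile t) (.load t t)

/-- The running time of the compiled expression. -/
def cost : Expr T → ℕ
  | reg _ => 2
  | const _ => 1
  | op _ a b => a.cost + (b.cost + 1)
  | load a => a.cost + 1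

/-- The exponent of a bound for the numbers that occur in the evaluation. -/
def weight : Expr T → ℕ
  | reg _ => 1
  | const c => c + 1
  | op _ a b => a.weight + b.weight
  | load a => a.weight

end Expr

/-- The registers below `T` and the memory of `s` have the contents `l` and `m`. -/
def Matches (T : ℕ) (l : List ℕ) (m : ℕ → ℕ) (s : State) : Prop :=
  s.mem = m ∧ ∀ r < T, s.reg r = l.getD r 0

/-- All numbers in the registers and the memory are at most `Y`. -/
def Bounded (Y : ℕ) (l : List ℕ) (m : ℕ → ℕ) : Prop :=
  (∀ x ∈ l, x ≤ Y) ∧ ∀ a, m a ≤ Y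

namespace Expr

variable {T : ℕ}

theorem one_le_weight (e : Expr T) : 1 ≤ e.weight := by
  induction e <;> simp_all [weight]
  omega

/-- Weights are at least `1`, so operands have bounds that are at least `2`; the product of two such
bounds also dominates their sum, and exponents add for every operation. -/
theorem eval_le {Y : ℕ} (hY : 2 ≤ Y) {l : List ℕ} {m : ℕ → ℕ} (hb : Bounded Y l m) (e : Expr T) :
    e.eval l m ≤ Y ^ e.weight := by
  induction e with
  | reg r =>
    rw [eval, weight, pow_one, List.getD_eq_getElem?_getD]
    rcases h : l[(r : ℕ)]? with _ | x
    · simp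
    · exact hb.1 x (List.mem_of_getElem? h)
  | const c =>
    exact ((Nat.lt_two_pow_self (n := c)).le.trans (Nat.pow_le_pow_right (by norm_num)
      (Nat.le_succ c))).trans (Nat.pow_le_pow_left hY _)
  | op o a b iha ihb =>
    have ha : 2 ≤ Y ^ a.weight := hY.trans (Nat.le_self_pow (by have := a.one_le_weight; omega) Y)
    have hb : 2 ≤ Y ^ b.weight := hY.trans (Nat.le_self_pow (by have := b.one_le_weight; omega) Y)
    rw [weight, pow_add, eval]
    cases o with
    | add => simp only [BinOp.eval]; nlinarith
    | sub => simp only [BinOp.eval]; exact (Nat.sub_le _ _).trans (by nlinarith)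
    | mul => simp only [BinOp.eval]; exact Nat.mul_le_mul iha ihb
    | div => simp only [BinOp.eval]; exact (Nat.div_le_self _ _).trans (by nlinarith)
  | load a iha =>
    exact (hb.2 _).trans (Nat.le_self_pow (by have := a.one_le_weight; simp [weight]; omega) Y)

/-- The registers from `t` on act as a stack: the left value rests in `t` while the right operand is
computed from `t + 1` on. -/
theorem exec_compile {W Y : ℕ} (hY : 2 ≤ Y) {l : List ℕ} {m : ℕ → ℕ} (hb : Bounded Y l m)
    (e : Expr T) (hW : Y ^ e.weight < W) (t : ℕ) (ht : T ≤ t) (s : State) (hs : Matches T l m s) :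
    ∃ s', Exec W (e.compile t) s e.cost s' ∧ s'.mem = s.mem ∧ (∀ r < t, s'.reg r = s.reg r) ∧
      s'.reg t = e.eval l m := by
  have hval := eval_le hY hb e
  induction e generalizing t s with
  | reg r =>
    have hrt : (r : ℕ) ≠ t := by have := r.2; omega
    have hr : ((s.setReg t 0).reg t) + ((s.setReg t 0).reg r) = l.getD r 0 := by
      simp [State.setReg, Function.update_of_ne hrt, hs.2 r r.2]
    refine ⟨_, .seq (.const _ _ _ (by omega)) (.op _ _ _ _ _ ?_), rfl, fun q hq => ?_, ?_⟩
    · rw [BinOp.eval, hr]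
      exact lt_of_le_of_lt hval hW
    · simp [State.setReg, Function.update_of_ne hq.ne]
    · simp only [BinOp.eval, hr]
      simp [State.setReg, eval]
  | const c =>
    refine ⟨_, .const _ _ _ (lt_of_le_of_lt hval hW), rfl, fun q hq => ?_, ?_⟩
    · simp [State.setReg, Function.update_of_ne hq.ne]
    · simp [State.setReg, eval]
  | op o a b iha ihb =>
    have hwa : Y ^ a.weight < W := lt_of_le_of_lt (Nat.pow_le_pow_right (by omega)
      (by simp [weight])) hW
    have hwb : Y ^ b.weight < W := lt_of_le_of_lt (Nat.pow_le_pow_right (by omega)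
      (by simp [weight])) hW
    obtain ⟨s₁, x₁, m₁, r₁, v₁⟩ := iha hwa t ht s hs (eval_le hY hb a)
    obtain ⟨s₂, x₂, m₂, r₂, v₂⟩ := ihb hwb (t + 1) (by omega) s₁
      ⟨m₁.trans hs.1, fun r hr => (r₁ r (by omega)).trans (hs.2 r hr)⟩ (eval_le hY hb b)
    have v₁' : s₂.reg t = a.eval l m := (r₂ t (by omega)).trans v₁
    refine ⟨_, .seq x₁ (.seq x₂ (.op _ _ _ _ _ ?_)), m₂.trans m₁, fun q hq => ?_, ?_⟩
    · rw [v₁', v₂]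
      exact lt_of_le_of_lt hval hW
    · simp [State.setReg, Function.update_of_ne hq.ne, r₂ q (by omega), r₁ q hq]
    · simp [State.setReg, eval, v₁', v₂]
  | load a iha =>
    obtain ⟨s₁, x₁, m₁, r₁, v₁⟩ := iha hW t ht s hs (eval_le hY hb a)
    refine ⟨_, .seq x₁ (.load _ _ _), m₁, fun q hq => ?_, ?_⟩
    · simp [State.setReg, Function.update_of_ne hq.ne, r₁ q hq]
    · simp [State.setReg, eval, v₁, m₁, hs.1]

end Expr

/-! ### Running times of composed programs -/

/-- From registers `l` and memory `m`, the program `P` leads to `l'` and `m'` in at most `B`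
steps; only the first `T` registers are considered. -/
def Runs (W T : ℕ) (P : Program) (l : List ℕ) (m : ℕ → ℕ) (B : ℕ) (l' : List ℕ) (m' : ℕ → ℕ) :
    Prop :=
  ∀ s, Matches T l m s → ∃ t s', Exec W P s t s' ∧ t ≤ B ∧ Matches T l' m' s'

section Runs

variable {W T : ℕ} {P Q : Program} {l l' l'' : List ℕ} {m m' m'' : ℕ → ℕ} {B B' : ℕ}

theorem Runs.seq (hP : Runs W T P l m B l' m') (hQ : Runs W T Q l' m' B' l'' m'') :
    Runs W T (.seq P Q) l m (B + B') l'' m'' := by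
  intro s hs
  obtain ⟨t, s', x, ht, hs'⟩ := hP s hs
  obtain ⟨t', s'', x', ht', hs''⟩ := hQ s' hs'
  exact ⟨_, _, .seq x x', by omega, hs''⟩

theorem Runs.mono (h : Runs W T P l m B l' m') (hB : B ≤ B') : Runs W T P l m B' l' m' := by
  intro s hs
  obtain ⟨t, s', x, ht, hs'⟩ := h s hs
  exact ⟨t, s', x, ht.trans hB, hs'⟩

theorem Runs.congr (h : Runs W T P l m B l' m') (hl : l' = l'') (hm : m' = m'') :
    Runs W T P l m B l'' m'' := hl ▸ hm ▸ h

/-- The states `σ i`, `μ i` after `i` rounds serve as loop invariant and fix the number of rounds.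
-/
theorem Runs.loop (a : ℕ) (ha : a < T) (M : ℕ) (σ : ℕ → List ℕ) (μ : ℕ → ℕ → ℕ)
    (h₀ : ∀ i < M, (σ i).getD a 0 ≠ 0)
    (h : ∀ i < M, Runs W T P (σ i) (μ i) B (σ (i + 1)) (μ (i + 1)))
    (hM : (σ M).getD a 0 = 0) :
    Runs W T (.loop a P) (σ 0) (μ 0) (M * (B + 1) + 1) (σ M) (μ M) := by
  have key : ∀ j i, i + j = M →
      Runs W T (.loop a P) (σ i) (μ i) (j * (B + 1) + 1) (σ M) (μ M) := by
    intro j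
    induction j with
    | zero =>
      rintro i rfl s hs
      exact ⟨1, s, .loop_done ((hs.2 a ha).trans hM), by omega, hs⟩
    | succ j ih =>
      intro i hi s hs
      obtain ⟨t, s', x, ht, hs'⟩ := h i (by omega) s hs
      obtain ⟨t', s'', x', ht', hs''⟩ := ih (i + 1) (by omega) s' hs'
      refine ⟨_, s'', .loop_step ?_ x x', ?_, hs''⟩
      · rw [hs.2 a ha]
        exact h₀ i (by omega)
      · rw [Nat.add_mul]
        omega
  exact key M 0 (by omega)

/-- `reg r := e` -/
def assign (r : ℕ) (e : Expr T) : Program :=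
  .seq (e.compile T) (.seq (.const (T + 1) 0) (.op .add r T (T + 1)))

/-- `mem[a] := b` -/
def storeAt (a b : Expr T) : Program :=
  .seq (a.compile T) (.seq (b.compile (T + 1)) (.store T (T + 1)))

theorem Runs.assign {Y : ℕ} (hY : 2 ≤ Y) (hb : Bounded Y l m) (r : ℕ) (e : Expr T)
    (hr : r < l.length) (hW : Y ^ e.weight < W) :
    Runs W T (assign r e) l m (e.cost + 2) (l.set r (e.eval l m)) m := by
  intro s hs
  obtain ⟨s₁, x₁, m₁, r₁, v₁⟩ := e.exec_compile hY hb hW T le_rfl s hs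
  have hv : (s₁.setReg (T + 1) 0).reg T + (s₁.setReg (T + 1) 0).reg (T + 1) = e.eval l m := by
    simp [State.setReg, v₁]
  refine ⟨_, _, .seq x₁ (.seq (.const _ _ _ (by omega)) (.op _ _ _ _ _ ?_)), le_rfl,
    m₁.trans hs.1, fun q hq => ?_⟩
  · rw [BinOp.eval, hv]
    exact lt_of_le_of_lt (e.eval_le hY hb) hW
  · rw [BinOp.eval, hv]
    by_cases hqr : q = r
    · subst hqr
      simp [State.setReg, hr]
    · have hq' : q ≠ T + 1 := by omega
      simp [State.setReg, Function.update_of_ne hqr, Function.update_of_ne hq', r₁ q hq, hs.2 q hq,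
        List.getElem?_set_ne (Ne.symm hqr)]

theorem Runs.storeAt {Y : ℕ} (hY : 2 ≤ Y) (hb : Bounded Y l m) (a b : Expr T)
    (hWa : Y ^ a.weight < W) (hWb : Y ^ b.weight < W) :
    Runs W T (storeAt a b) l m (a.cost + b.cost + 1) l
      (Function.update m (a.eval l m) (b.eval l m)) := by
  intro s hs
  obtain ⟨s₁, x₁, m₁, r₁, v₁⟩ := a.exec_compile hY hb hWa T le_rfl s hs
  obtain ⟨s₂, x₂, m₂, r₂, v₂⟩ := b.exec_compile hY hb hWb (T + 1) (by omega) s₁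
    ⟨m₁.trans hs.1, fun r hr => (r₁ r hr).trans (hs.2 r hr)⟩
  refine ⟨_, _, .seq x₁ (.seq x₂ (.store _ _ _)), by omega, ?_, fun q hq => ?_⟩
  · rw [← v₂, ← v₁, ← hs.1, ← m₁, ← m₂, ← r₂ T (by omega)]
    rfl
  · exact (r₂ q (by omega)).trans ((r₁ q hq).trans (hs.2 q hq))

end Runs

/-! ### Truth values as arithmetic -/

namespace Expr

variable {T : ℕ} {l : List ℕ} {m : ℕ → ℕ}

/-- Addition of expressions; as a truth value (`0` is false) their disjunction. -/
def add (a b : Expr T) : Expr T := op .add a b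
/-- Truncated subtraction of expressions. -/
def sub (a b : Expr T) : Expr T := op .sub a b
/-- Multiplication of expressions; as a truth value (`0` is false) their conjunction. -/
def mul (a b : Expr T) : Expr T := op .mul a b
/-- Division of expressions. -/
def div (a b : Expr T) : Expr T := op .div a b
/-- The remainder. -/
def mod (a b : Expr T) : Expr T := a.sub (b.mul (a.div b))
/-- Negation of a truth value. -/
def not (a : Expr T) : Expr T := (const 1).sub a
/-- The truth value as `0` or `1`. -/
def bit (a : Expr T) : Expr T := a.not.not
/-- The truth value of an equation. -/
def eq (a b : Expr T) : Expr T := ((a.sub b).add (b.sub a)).not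
/-- The truth value of a strict inequality. -/
def lt (a b : Expr T) : Expr T := ((a.add (const 1)).sub b).not
/-- If `c` then `a` else `b`. -/
def ite (c a b : Expr T) : Expr T := (c.bit.mul a).add (c.not.mul b)

/-- The expression `e` is true (not `0`) if and only if `p` holds. -/
def Decides (l : List ℕ) (m : ℕ → ℕ) (e : Expr T) (p : Prop) : Prop := e.eval l m ≠ 0 ↔ p

@[simp] theorem eval_const (c : ℕ) : (const c : Expr T).eval l m = c := rfl
@[simp] theorem eval_reg (r : Fin T) : (reg r).eval l m = l.getD r 0 := rfl
@[simp] theorem eval_load (a : Expr T) : (load a).eval l m = m (a.eval l m) := rfl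
@[simp] theorem eval_add (a b : Expr T) : (a.add b).eval l m = a.eval l m + b.eval l m := rfl
@[simp] theorem eval_sub (a b : Expr T) : (a.sub b).eval l m = a.eval l m - b.eval l m := rfl
@[simp] theorem eval_mul (a b : Expr T) : (a.mul b).eval l m = a.eval l m * b.eval l m := rfl
@[simp] theorem eval_div (a b : Expr T) : (a.div b).eval l m = a.eval l m / b.eval l m := rfl

@[simp] theorem eval_mod (a b : Expr T) : (a.mod b).eval l m = a.eval l m % b.eval l m := by
  simp [mod, Nat.mod_eq_sub]

theorem Decides.not {a : Expr T} {p : Prop} (h : a.Decides l m p) : a.not.Decides l m (¬ p) := by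
  unfold Decides at *
  rw [← h, Expr.not, eval_sub, eval_const]
  omega

theorem Decides.or {a b : Expr T} {p q : Prop} (ha : a.Decides l m p) (hb : b.Decides l m q) :
    (a.add b).Decides l m (p ∨ q) := by
  unfold Decides at *
  rw [← ha, ← hb, eval_add]
  omega

theorem Decides.and {a b : Expr T} {p q : Prop} (ha : a.Decides l m p) (hb : b.Decides l m q) :
    (a.mul b).Decides l m (p ∧ q) := by
  unfold Decides at *
  rw [← ha, ← hb, eval_mul, mul_ne_zero_iff]

theorem decides_eq (a b : Expr T) : (a.eq b).Decides l m (a.eval l m = b.eval l m) := by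
  rw [Decides, Expr.eq, Expr.not, eval_sub, eval_const, eval_add, eval_sub, eval_sub]
  omega

open Classical in
theorem Decides.eval_bit {a : Expr T} {p : Prop} (h : a.Decides l m p) :
    a.bit.eval l m = if p then 1 else 0 := by
  unfold Decides at h
  rw [bit, Expr.not, eval_sub, eval_const, Expr.not, eval_sub, eval_const]
  split_ifs with hp
  · have := h.2 hp
    omega
  · have := mt h.1 hp
    omega

open Classical in
theorem Decides.eval_ite {c a b : Expr T} {p : Prop} (h : c.Decides l m p) :
    (c.ite a b).eval l m = if p then a.eval l m else b.eval l m := by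
  rw [Expr.ite, eval_add, eval_mul, eval_mul, h.eval_bit]
  have hn : c.not.eval l m = if p then 0 else 1 := by
    unfold Decides at h
    rw [Expr.not, eval_sub, eval_const]
    split_ifs with hp
    · have := h.2 hp
      omega
    · have := mt h.1 hp
      omega
  rw [hn]
  split_ifs <;> simp

@[simp] theorem eval_eq (a b : Expr T) :
    (a.eq b).eval l m = if a.eval l m = b.eval l m then 1 else 0 := by
  rw [Expr.eq, Expr.not, eval_sub, eval_const, eval_add, eval_sub, eval_sub]
  split_ifs <;> omega

@[simp] theorem eval_lt (a b : Expr T) :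
    (a.lt b).eval l m = if a.eval l m < b.eval l m then 1 else 0 := by
  rw [Expr.lt, Expr.not, eval_sub, eval_const, eval_sub, eval_add, eval_const]
  split_ifs <;> omega

theorem decides_lt (a b : Expr T) : (a.lt b).Decides l m (a.eval l m < b.eval l m) := by
  rw [Decides, eval_lt]
  split_ifs with h <;> simp [h]

end Expr

end WordRAM

/-! ### Expressions that test the covering conditions -/

namespace WordRAM

namespace Expr

variable {T : ℕ} {l : List ℕ} {m : ℕ → ℕ} {n : ℕ}

/-- The truth value of the equality of two edges, given by their endpoints. -/
def sameEdge (e f : Expr T × Expr T) : Expr T :=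
  ((e.1.eq f.1).mul (e.2.eq f.2)).add ((e.1.eq f.2).mul (e.2.eq f.1))

/-- The truth value of the incidence of a vertex with an edge. -/
def onEdge (v : Expr T) (e : Expr T × Expr T) : Expr T := (v.eq e.1).add (v.eq e.2)

/-- The truth value of `Crosses e f`. -/
def crossing (e f : Expr T × Expr T) : Expr T :=
  (sameEdge e f).not.mul ((onEdge e.1 f).add (onEdge e.2 f))

/-- The truth value of `e ∈ G.edgeSet`; `n` is the number of vertices. -/
def isEdge (n : Expr T) (e : Expr T × Expr T) : Expr T := load ((e.1.mul n).add e.2)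

/-- The truth value of `IsQuad`. -/
def quad (n : Expr T) (e₁ e₂ f₁ f₂ : Expr T × Expr T) : Expr T :=
  ((isEdge n e₁).mul ((isEdge n e₂).mul ((isEdge n f₁).mul (isEdge n f₂)))).mul
    ((crossing e₁ f₁).mul ((crossing e₁ f₂).mul ((crossing e₂ f₁).mul (crossing e₂ f₂))))

/-- The truth value of `EndCovers`. -/
def endCovers (e₁ e₂ f₁ f₂ g h : Expr T × Expr T) : Expr T :=
  (sameEdge g e₁).add ((sameEdge g f₁).add (((sameEdge g e₂).mul (crossing h e₁)).add
    ((sameEdge g f₂).mul (crossing h f₁))))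

/-- The truth value of the incidence of a vertex with both `g` and `h` and with a quadruple. -/
def common (v : Expr T) (e₁ e₂ f₁ f₂ h : Expr T × Expr T) : Expr T :=
  (onEdge v h).mul ((onEdge v e₁).mul ((onEdge v e₂).mul ((onEdge v f₁).mul (onEdge v f₂))))

/-- The truth value of `QuadCovers`. -/
def quadCovers (n : Expr T) (e₁ e₂ f₁ f₂ g h : Expr T × Expr T) : Expr T :=
  (quad n e₁ e₂ f₁ f₂).mul ((endCovers e₁ e₂ f₁ f₂ g h).add ((endCovers e₁ e₂ f₁ f₂ h g).add
    ((common g.1 e₁ e₂ f₁ f₂ h).add (common g.2 e₁ e₂ f₁ f₂ h))))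

/-- The values of two expressions are the endpoints of the edge `e`. -/
def Represents (l : List ℕ) (m : ℕ → ℕ) (p : Expr T × Expr T) (e : Sym2 (Fin n)) : Prop :=
  ∃ a b : Fin n, e = s(a, b) ∧ p.1.eval l m = a ∧ p.2.eval l m = b

theorem decides_sameEdge {p q : Expr T × Expr T} {e f : Sym2 (Fin n)} (hp : Represents l m p e)
    (hq : Represents l m q f) : (sameEdge p q).Decides l m (e = f) := by
  obtain ⟨a, b, rfl, ha, hb⟩ := hp
  obtain ⟨c, d, rfl, hc, hd⟩ := hq
  have := ((decides_eq (l := l) (m := m) p.1 q.1).and (decides_eq p.2 q.2)).or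
    ((decides_eq p.1 q.2).and (decides_eq p.2 q.1))
  simpa only [sameEdge, ha, hb, hc, hd, Fin.val_inj, ← Sym2.eq_iff] using this

theorem decides_onEdge {x : Expr T} {q : Expr T × Expr T} {v : Fin n} {f : Sym2 (Fin n)}
    (hx : x.eval l m = v) (hq : Represents l m q f) : (onEdge x q).Decides l m (v ∈ f) := by
  obtain ⟨c, d, rfl, hc, hd⟩ := hq
  have := (decides_eq (l := l) (m := m) x q.1).or (decides_eq x q.2)
  simpa only [onEdge, hx, hc, hd, Fin.val_inj, ← Sym2.mem_iff] using this

theorem decides_crossing {p q : Expr T × Expr T} {e f : Sym2 (Fin n)} (hp : Represents l m p e)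
    (hq : Represents l m q f) : (crossing p q).Decides l m (Crosses e f) := by
  have h := (decides_sameEdge hp hq).not
  obtain ⟨a, b, rfl, ha, hb⟩ := hp
  have := h.and ((decides_onEdge ha hq).or (decides_onEdge hb hq))
  simpa only [crossing, Crosses, ne_eq, Sym2.mem_iff, or_and_right, exists_or, exists_eq_left] using this

theorem decides_isEdge {G : SimpleGraph (Fin n)} {x : Expr T} (hx : x.eval l m = n)
    (hm : ∀ a b : Fin n, m (a * n + b) ≠ 0 ↔ G.Adj a b) {p : Expr T × Expr T} {e : Sym2 (Fin n)}
    (hp : Represents l m p e) : (isEdge x p).Decides l m (e ∈ G.edgeSet) := by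
  obtain ⟨a, b, rfl, ha, hb⟩ := hp
  simp only [Decides, isEdge, eval_load, eval_add, eval_mul, ha, hb, hx, hm,
    SimpleGraph.mem_edgeSet]

variable {e₁ e₂ f₁ f₂ g h : Sym2 (Fin n)} {q₁ q₂ r₁ r₂ u v : Expr T × Expr T}

theorem decides_quad {G : SimpleGraph (Fin n)} {x : Expr T} (hx : x.eval l m = n)
    (hm : ∀ a b : Fin n, m (a * n + b) ≠ 0 ↔ G.Adj a b) (h₁ : Represents l m q₁ e₁)
    (h₂ : Represents l m q₂ e₂) (h₃ : Represents l m r₁ f₁) (h₄ : Represents l m r₂ f₂) :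
    (quad x q₁ q₂ r₁ r₂).Decides l m (IsQuad G e₁ e₂ f₁ f₂) :=
  (((decides_isEdge hx hm h₁).and ((decides_isEdge hx hm h₂).and ((decides_isEdge hx hm h₃).and
    (decides_isEdge hx hm h₄))))).and ((decides_crossing h₁ h₃).and ((decides_crossing h₁ h₄).and
    ((decides_crossing h₂ h₃).and (decides_crossing h₂ h₄))))

theorem decides_endCovers (h₁ : Represents l m q₁ e₁) (h₂ : Represents l m q₂ e₂)
    (h₃ : Represents l m r₁ f₁) (h₄ : Represents l m r₂ f₂) (hu : Represents l m u g)
    (hv : Represents l m v h) :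
    (endCovers q₁ q₂ r₁ r₂ u v).Decides l m (EndCovers e₁ e₂ f₁ f₂ g h) :=
  (decides_sameEdge hu h₁).or ((decides_sameEdge hu h₃).or
    (((decides_sameEdge hu h₂).and (decides_crossing hv h₁)).or
    ((decides_sameEdge hu h₄).and (decides_crossing hv h₃))))

theorem decides_quadCovers {G : SimpleGraph (Fin n)} {x : Expr T} (hx : x.eval l m = n)
    (hm : ∀ a b : Fin n, m (a * n + b) ≠ 0 ↔ G.Adj a b) (h₁ : Represents l m q₁ e₁)
    (h₂ : Represents l m q₂ e₂) (h₃ : Represents l m r₁ f₁) (h₄ : Represents l m r₂ f₂)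
    (hu : Represents l m u g) (hv : Represents l m v h) :
    (quadCovers x q₁ q₂ r₁ r₂ u v).Decides l m (QuadCovers G e₁ e₂ f₁ f₂ g h) := by
  have hc : ∀ {y : Expr T} {a : Fin n}, y.eval l m = a → (common y q₁ q₂ r₁ r₂ v).Decides l m
      (a ∈ h ∧ a ∈ e₁ ∧ a ∈ e₂ ∧ a ∈ f₁ ∧ a ∈ f₂) := fun ha =>
    (decides_onEdge ha hv).and ((decides_onEdge ha h₁).and ((decides_onEdge ha h₂).and
      ((decides_onEdge ha h₃).and (decides_onEdge ha h₄))))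
  have hE := decides_endCovers h₁ h₂ h₃ h₄ hu hv
  have hE' := decides_endCovers h₁ h₂ h₃ h₄ hv hu
  obtain ⟨a, b, rfl, ha, hb⟩ := hu
  have := (decides_quad hx hm h₁ h₂ h₃ h₄).and (hE.or (hE'.or ((hc ha).or (hc hb))))
  simpa only [quadCovers, QuadCovers, Sym2.mem_iff, and_assoc, or_and_right, exists_or, exists_eq_left]
    using this

/-- The base vertex number `i` of the code `d`. -/
def base (n d : Expr T) (i : ℕ) : Expr T :=
  if i = 0 then d.mod n else if i = 1 then (d.div n).mod n
    else if i = 2 then ((d.div n).div n).mod n else (((d.div n).div n).div n).mod n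

/-- The value of `codeRest`. -/
def rest (n d : Expr T) : Expr T := (((d.div n).div n).div n).div n

/-- The value of `codeFifth`. -/
def fifth (n d : Expr T) : Expr T := ((((d.div n).mod n).add (const 1)).add (rest n d)).mod n

/-- The base vertex whose number is the value of an expression. -/
def baseAt (n d i : Expr T) : Expr T :=
  ite (i.eq (const 0)) (base n d 0) (ite (i.eq (const 1)) (base n d 1)
    (ite (i.eq (const 2)) (base n d 2) (base n d 3)))

/-- The base-four digit number `i` of the rest of a code. -/
def digit (n d : Expr T) (i : ℕ) : Expr T :=
  (((rest n d).sub (n.div (const 2))).div (const (4 ^ i))).mod (const 4)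

/-- The endpoints of `codeEdge`. -/
def edge (n d : Expr T) (i : ℕ) (x : Expr T) : Expr T × Expr T :=
  (ite ((rest n d).lt (n.div (const 2))) (base n d 0) (baseAt n d (digit n d (2 * i))),
    ite ((rest n d).lt (n.div (const 2))) x (baseAt n d (digit n d (2 * i + 1))))

/-- The truth value of `CodeCovers`. -/
def codeCovers (n d : Expr T) (g h : Expr T × Expr T) : Expr T :=
  quadCovers n (edge n d 0 (base n d 1)) (edge n d 1 (base n d 2)) (edge n d 2 (fifth n d))
    (edge n d 3 (base n d 3)) g h

variable {x d : Expr T}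

theorem eval_rest (hx : x.eval l m = n) : (rest x d).eval l m = codeRest n (d.eval l m) := by
  simp only [rest, eval_div, hx, codeRest]

theorem eval_digit (hx : x.eval l m = n) (i : ℕ) :
    (digit x d i).eval l m = (codeRest n (d.eval l m) - n / 2) / 4 ^ i % 4 := by
  simp only [digit, eval_mod, eval_div, eval_sub, eval_const, eval_rest hx, hx]

variable [NeZero n]

theorem eval_base (hx : x.eval l m = n) (i : ℕ) :
    (base x d i).eval l m = codeBase n (d.eval l m) i := by
  unfold base codeBase
  split_ifs <;> simp only [eval_mod, eval_div, hx, Fin.val_ofNat]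

theorem eval_fifth (hx : x.eval l m = n) :
    (fifth x d).eval l m = codeFifth n (d.eval l m) := by
  simp only [fifth, eval_mod, eval_add, eval_div, eval_const, eval_rest hx, hx, codeFifth,
    Fin.val_ofNat]

theorem eval_baseAt (hx : x.eval l m = n) (i : Expr T) :
    (baseAt x d i).eval l m = codeBase n (d.eval l m) (i.eval l m) := by
  simp only [baseAt, (decides_eq _ _).eval_ite, eval_const, eval_base hx]
  split_ifs with h₀ h₁ h₂
  · rw [h₀]
  · rw [h₁]
  · rw [h₂]
  · simp [codeBase, h₀, h₁, h₂]

theorem represents_edge (hx : x.eval l m = n) (i : ℕ) {y : Expr T} {v : Fin n}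
    (hy : y.eval l m = v) : Represents l m (edge x d i y) (codeEdge n (d.eval l m) i v) := by
  unfold codeEdge
  simp only [Represents, edge, (decides_lt _ _).eval_ite, eval_rest hx, eval_div, hx, eval_const,
    eval_baseAt hx, eval_base hx, eval_digit hx, hy]
  split_ifs
  exacts [⟨_, _, rfl, rfl, rfl⟩, ⟨_, _, rfl, rfl, rfl⟩]

theorem decides_codeCovers {G : SimpleGraph (Fin n)} (hx : x.eval l m = n)
    (hm : ∀ a b : Fin n, m (a * n + b) ≠ 0 ↔ G.Adj a b) (hu : Represents l m u g)
    (hv : Represents l m v h) :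
    (codeCovers x d u v).Decides l m (CodeCovers G (d.eval l m) g h) :=
  decides_quadCovers hx hm (represents_edge hx 0 (eval_base hx 1))
    (represents_edge hx 1 (eval_base hx 2)) (represents_edge hx 2 (eval_fifth hx))
    (represents_edge hx 3 (eval_base hx 3)) hu hv

end Expr

end WordRAM

/-! ### Runs that keep all numbers bounded -/

namespace WordRAM

/-- `Runs` together with the preservation of a bound for all numbers. -/
def BoundedRuns (W T Y : ℕ) (P : Program) (l : List ℕ) (m : ℕ → ℕ) (B : ℕ) (l' : List ℕ)
    (m' : ℕ → ℕ) : Prop :=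
  Bounded Y l m → Runs W T P l m B l' m' ∧ Bounded Y l' m'

/-- The expressions in the list `es` can be evaluated in time and space. -/
def Feasible {T : ℕ} (W Y K : ℕ) (es : List (Expr T)) : Prop :=
  ∀ e ∈ es, e.cost + 2 ≤ K ∧ Y ^ e.weight < W

section BoundedRuns

variable {W T Y K : ℕ} {P Q : Program} {l l' l'' : List ℕ} {m m' m'' : ℕ → ℕ} {B B' : ℕ}

theorem BoundedRuns.seq (hP : BoundedRuns W T Y P l m B l' m')
    (hQ : BoundedRuns W T Y Q l' m' B' l'' m'') :
    BoundedRuns W T Y (.seq P Q) l m (B + B') l'' m'' := fun hb =>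
  ⟨(hP hb).1.seq (hQ (hP hb).2).1, (hQ (hP hb).2).2⟩

theorem BoundedRuns.mono (h : BoundedRuns W T Y P l m B l' m') (hB : B ≤ B') :
    BoundedRuns W T Y P l m B' l' m' := fun hb => ⟨(h hb).1.mono hB, (h hb).2⟩

theorem BoundedRuns.loop (a : ℕ) (ha : a < T) (M : ℕ) (σ : ℕ → List ℕ) (μ : ℕ → ℕ → ℕ)
    (h₀ : ∀ i < M, (σ i).getD a 0 ≠ 0)
    (h : ∀ i < M, BoundedRuns W T Y P (σ i) (μ i) B (σ (i + 1)) (μ (i + 1)))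
    (hM : (σ M).getD a 0 = 0) :
    BoundedRuns W T Y (.loop a P) (σ 0) (μ 0) (M * (B + 1) + 1) (σ M) (μ M) := by
  intro hb
  have hb' : ∀ i ≤ M, Bounded Y (σ i) (μ i) := by
    intro i hi
    induction i with
    | zero => exact hb
    | succ i ih => exact (h i hi (ih (by omega))).2
  exact ⟨.loop a ha M σ μ h₀ (fun i hi => (h i hi (hb' i hi.le)).1) hM, hb' M le_rfl⟩

theorem BoundedRuns.assign {es : List (Expr T)} (hY : 2 ≤ Y) (hE : Feasible W Y K es) (r : ℕ)
    (e : Expr T) (he : e ∈ es) (v : ℕ) (hv : e.eval l m = v) (hvY : v ≤ Y) (hr : r < l.length)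
    (hl : l.set r v = l') : BoundedRuns W T Y (assign r e) l m K l' m := by
  subst hv hl
  exact fun hb => ⟨(Runs.assign hY hb r e hr (hE e he).2).mono (hE e he).1,
    fun x hx => (List.mem_or_eq_of_mem_set hx).elim (hb.1 x) (fun h => h ▸ hvY), hb.2⟩

theorem BoundedRuns.storeAt {es : List (Expr T)} (hY : 2 ≤ Y) (hE : Feasible W Y K es)
    (a b : Expr T) (ha : a ∈ es) (hb : b ∈ es) (u v : ℕ) (hu : a.eval l m = u)
    (hv : b.eval l m = v) (hvY : v ≤ Y) (hm : Function.update m u v = m') :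
    BoundedRuns W T Y (storeAt a b) l m (2 * K) l m' := by
  subst hu hv hm
  have h₁ := (hE a ha).1
  have h₂ := (hE b hb).1
  refine fun h => ⟨(Runs.storeAt hY h a b (hE a ha).2 (hE b hb).2).mono (by omega), h.1, ?_⟩
  intro x
  by_cases hx : x = a.eval l m
  · subst hx
    simpa using hvY
  · rw [Function.update_of_ne hx]
    exact h.2 x

end BoundedRuns

open Classical in
/-- The bit of a proposition. -/
noncomputable def bitOf (p : Prop) : ℕ := if p then 1 else 0

theorem bitOf_le {Y : ℕ} (hY : 2 ≤ Y) (p : Prop) : bitOf p ≤ Y := by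
  unfold bitOf
  split_ifs <;> omega

theorem bitOf_congr {p q : Prop} (h : p ↔ q) : bitOf p = bitOf q := by
  rw [propext h]

theorem bitOf_of {p : Prop} (h : p) : bitOf p = 1 := if_pos h

theorem bitOf_of_not {p : Prop} (h : ¬ p) : bitOf p = 0 := if_neg h

theorem bitOf_ne_zero {p : Prop} : bitOf p ≠ 0 ↔ p := by
  unfold bitOf
  split_ifs with h <;> simp [h]

namespace Expr

variable {T : ℕ} {l : List ℕ} {m : ℕ → ℕ}

theorem Decides.eval_bit' {a : Expr T} {p : Prop} (h : a.Decides l m p) :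
    a.bit.eval l m = bitOf p := h.eval_bit

theorem Decides.eval_not {a : Expr T} {p : Prop} (h : a.Decides l m p) :
    a.not.eval l m = bitOf (¬ p) := by
  unfold Decides at h
  rw [Expr.not, eval_sub, eval_const]
  by_cases hp : p
  · rw [bitOf_of_not (not_not.2 hp)]
    have := h.2 hp
    omega
  · rw [bitOf_of hp]
    have := mt h.1 hp
    omega

theorem eval_lt' (a b : Expr T) : (a.lt b).eval l m = bitOf (a.eval l m < b.eval l m) := by
  rw [eval_lt, bitOf]
  split_ifs <;> rfl

theorem eval_eq' (a b : Expr T) : (a.eq b).eval l m = bitOf (a.eval l m = b.eval l m) := by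
  rw [eval_eq, bitOf]
  split_ifs <;> rfl

theorem decides_of_bitOf {a : Expr T} {p : Prop} (h : a.eval l m = bitOf p) : a.Decides l m p := by
  rw [Decides, h, bitOf_ne_zero]

end Expr

/-! ### The program -/

namespace Boxicity

open WordRAM.Expr

/-- The number of codes. -/
def numExpr : Expr 12 :=
  ((((reg 0).mul (reg 0)).mul (reg 0)).mul (reg 0)).mul (((reg 0).div (const 2)).add (const 65536))

/-- Is `k < n`? -/
def moreInitExpr : Expr 12 := (reg 1).lt (reg 0)

/-- Is `n ≤ k`? -/
def foundInitExpr : Expr 12 := ((reg 1).lt (reg 0)).not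

/-- Is the number of the current pair of edges less than `n ^ 3`? -/
def pairCondExpr : Expr 12 := (reg 6).lt (((reg 0).mul (reg 0)).mul (reg 0))

/-- Is the current position less than `k`? -/
def posCondExpr : Expr 12 := (reg 8).lt (reg 1)

/-- The address of the code at the current position. -/
def addrExpr : Expr 12 := ((reg 0).mul (reg 0)).add (reg 8)

/-- The first edge of the current pair. -/
def fstExpr : Expr 12 × Expr 12 := (base (reg 0) (reg 6) 2, base (reg 0) (reg 6) 1)

/-- The second edge of the current pair. -/
def sndExpr : Expr 12 × Expr 12 := (base (reg 0) (reg 6) 2, base (reg 0) (reg 6) 0)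

/-- Is the current pair covered by the codes up to the current position? -/
def coveredExpr : Expr 12 :=
  ((reg 7).add (codeCovers (reg 0) (load addrExpr) fstExpr sndExpr)).bit

/-- The next position. -/
def posSuccExpr : Expr 12 := (reg 8).add (const 1)

/-- The next pair. -/
def pairSuccExpr : Expr 12 := (reg 6).add (const 1)

/-- Are all pairs up to the current one covered? -/
def okExpr : Expr 12 :=
  ((reg 5).mul ((((isEdge (reg 0) fstExpr).mul (isEdge (reg 0) sndExpr)).mul
    (fstExpr.2.eq sndExpr.2).not).not.add (reg 7))).bit

/-- Has a covering tuple of codes been found? -/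
def foundExpr : Expr 12 := ((reg 3).add (reg 5)).bit

/-- The code at the current position plus the carry. -/
def sumExpr : Expr 12 := (load addrExpr).add (reg 11)

/-- The next carry. -/
def carryExpr : Expr 12 := (reg 7).eq (reg 2)

/-- The next code at the current position. -/
def digitExpr : Expr 12 := (reg 7).mul (reg 11).not

/-- Is there another tuple? -/
def moreExpr : Expr 12 := (reg 11).not

/-- All expressions of the program. -/
def exprs : List (Expr 12) :=
  [const 0, const 1, reg 3, numExpr, moreInitExpr, foundInitExpr, pairCondExpr, posCondExpr,
    addrExpr, coveredExpr, posSuccExpr, pairSuccExpr, okExpr, foundExpr, sumExpr, carryExpr,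
    digitExpr, moreExpr]

/-- Test whether the current pair is covered. -/
def coveredLoop : Program :=
  .loop 10 (.seq (assign 7 coveredExpr) (.seq (assign 8 posSuccExpr) (assign 10 posCondExpr)))

/-- Test all pairs. -/
def pairLoop : Program :=
  .loop 9 (.seq (assign 10 posCondExpr) (.seq coveredLoop (.seq (assign 5 okExpr)
    (.seq (assign 7 (const 0 : Expr 12)) (.seq (assign 8 (const 0 : Expr 12))
      (.seq (assign 6 pairSuccExpr) (assign 9 pairCondExpr)))))))

/-- Pass to the next tuple of codes. -/
def nextLoop : Program :=
  .loop 10 (.seq (assign 7 sumExpr) (.seq (assign 11 carryExpr) (.seq (storeAt addrExpr digitExpr)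
    (.seq (assign 7 (const 0 : Expr 12)) (.seq (assign 8 posSuccExpr) (assign 10 posCondExpr))))))

/-- Test all tuples of codes. -/
def tupleLoop : Program :=
  .loop 4 (.seq (assign 5 (const 1 : Expr 12)) (.seq (assign 9 pairCondExpr) (.seq pairLoop
    (.seq (assign 3 foundExpr) (.seq (assign 5 (const 0 : Expr 12))
    (.seq (assign 6 (const 0 : Expr 12)) (.seq (assign 11 (const 1 : Expr 12))
    (.seq (assign 10 posCondExpr) (.seq nextLoop (.seq (assign 4 moreExpr)
    (.seq (assign 8 (const 0 : Expr 12)) (assign 11 (const 0 : Expr 12)))))))))))))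

/-- The program that decides whether the boxicity of the complement of the line graph is at
most `k`. -/
def program : Program :=
  .seq (assign 2 numExpr) (.seq (assign 3 foundInitExpr) (.seq (assign 4 moreInitExpr)
    (.seq tupleLoop (assign 0 (reg 3 : Expr 12)))))

/-! ### Memory layout and loop invariants -/

/-- The memory with the adjacency matrix `A` and the codes `D`. -/
def memOf (n : ℕ) (A D : ℕ → ℕ) (a : ℕ) : ℕ := if a < n * n then A a else D (a - n * n)

theorem memOf_add (n : ℕ) (A D : ℕ → ℕ) (j : ℕ) : memOf n A D (n * n + j) = D j := by
  simp [memOf]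

theorem update_memOf (n : ℕ) (A D : ℕ → ℕ) (j v : ℕ) :
    Function.update (memOf n A D) (n * n + j) v = memOf n A (Function.update D j v) := by
  ext a
  by_cases ha : a = n * n + j
  · subst ha
    simp [memOf]
  · rw [Function.update_of_ne ha, memOf, memOf]
    split_ifs with h
    · rfl
    · rw [Function.update_of_ne (by omega)]

/-- The digits of `t` in base `N`, up to position `k`. -/
def digits (N k t j : ℕ) : ℕ := if j < k then t / N ^ j % N else 0

section Correctness

variable {W Y K n k N : ℕ} [NeZero n] {G : SimpleGraph (Fin n)} {A : ℕ → ℕ}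

/-- The pair number `z` is covered by the first `i` of the codes `D`. -/
def PairCovered (G : SimpleGraph (Fin n)) (D : ℕ → ℕ) (z i : ℕ) : Prop :=
  ∃ j < i, CodeCovers G (D j) s(codeBase n z 2, codeBase n z 1) s(codeBase n z 2, codeBase n z 0)

/-- The pair number `z` is no pair of distinct edges, or it is covered. -/
def PairOk (G : SimpleGraph (Fin n)) (D : ℕ → ℕ) (z k : ℕ) : Prop :=
  G.Adj (codeBase n z 2) (codeBase n z 1) → G.Adj (codeBase n z 2) (codeBase n z 0) →
    codeBase n z 1 ≠ codeBase n z 0 → PairCovered G D z k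

/-- A pair of edges at `c` with other ends `a` and `b` has the number `b + n * a + n ^ 2 * c`, so
that `codeBase` also decodes pairs. -/
theorem codesCover_iff (G : SimpleGraph (Fin n)) (k : ℕ) (D : ℕ → ℕ) :
    CodesCover G k D ↔ ∀ z < n * n * n, PairOk G D z k := by
  constructor
  · exact fun h z _ h₁ h₂ h₃ => h _ _ _ h₁ h₂ h₃
  · intro h c a b hca hcb hab
    have hn : 0 < n := NeZero.pos n
    have hd : ∀ (a : Fin n) x, (a + n * x) / n = x := fun a x => by
      rw [Nat.add_mul_div_left _ _ hn, Nat.div_eq_of_lt a.2, zero_add]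
    have hm : ∀ (a : Fin n) x, Fin.ofNat n (a + n * x) = a := fun a x => by
      ext; simp [Nat.mod_eq_of_lt a.2]
    have hz : b + n * (a + n * (c + n * 0)) < n * n * n := by
      have hl : ∀ (a : Fin n) x y, x < y → a + n * x < n * y := fun a x y h => by
        have := a.2; nlinarith
      rw [mul_assoc]
      exact hl _ _ _ (hl _ _ _ (by simp))
    have := h _ hz
    unfold PairOk PairCovered at this
    simp only [codeBase, hd, hm, if_true, if_false, one_ne_zero, OfNat.ofNat_ne_zero,
      OfNat.ofNat_ne_one] at this
    exact this hca hcb hab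

theorem represents_fst (m : ℕ → ℕ) (k N f o q z c j zc jc y : ℕ) :
    Represents [n, k, N, f, o, q, z, c, j, zc, jc, y] m fstExpr
      s(codeBase n z 2, codeBase n z 1) :=
  ⟨_, _, rfl, eval_base (n := n) rfl 2, eval_base (n := n) rfl 1⟩

theorem represents_snd (m : ℕ → ℕ) (k N f o q z c j zc jc y : ℕ) :
    Represents [n, k, N, f, o, q, z, c, j, zc, jc, y] m sndExpr
      s(codeBase n z 2, codeBase n z 0) :=
  ⟨_, _, rfl, eval_base (n := n) rfl 2, eval_base (n := n) rfl 0⟩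

/-- The registers hold, in order: `n`, `k`, `N`, found, more tuples, all pairs fine so far, pair
number, covered flag (or scratch), position, pair condition, position condition, carry. -/
theorem coveredLoop_runs (hY : 2 ≤ Y) (hE : Feasible W Y K exprs) (hkY : k ≤ Y) {D : ℕ → ℕ}
    (hA : ∀ a b : Fin n, memOf n A D (a * n + b) ≠ 0 ↔ G.Adj a b) (f o q z zc y : ℕ) :
    BoundedRuns W 12 Y coveredLoop [n, k, N, f, o, q, z, 0, 0, zc, bitOf (0 < k), y] (memOf n A D)
      (k * (K + (K + K) + 1) + 1)
      [n, k, N, f, o, q, z, bitOf (PairCovered G D z k), k, zc, 0, y] (memOf n A D) := by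
  have h := BoundedRuns.loop (W := W) (T := 12) (Y := Y) (B := K + (K + K))
    (P := .seq (assign 7 coveredExpr) (.seq (assign 8 posSuccExpr) (assign 10 posCondExpr)))
    10 (by norm_num) k
    (fun i => [n, k, N, f, o, q, z, bitOf (PairCovered G D z i), i, zc, bitOf (i < k), y])
    (fun _ => memOf n A D) (fun i hi => by simp [bitOf_of hi]) (fun i hi => ?_)
    (by simp [bitOf])
  · simpa only [coveredLoop, bitOf_of_not (p := PairCovered G D z 0) (by simp [PairCovered]),
      bitOf_of_not (lt_irrefl k)] using h
  · refine (BoundedRuns.assign hY hE 7 coveredExpr (by simp [exprs]) (bitOf (PairCovered G D z (i + 1)))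
      ?_ (bitOf_le hY _) (by simp) rfl).seq ((BoundedRuns.assign hY hE 8 posSuccExpr (by simp [exprs]) (i + 1)
      rfl (by omega) (by simp) rfl).seq (BoundedRuns.assign hY hE 10 posCondExpr (by simp [exprs])
      (bitOf (i + 1 < k)) (eval_lt' _ _) (bitOf_le hY _) (by simp) rfl))
    refine (((decides_of_bitOf (p := PairCovered G D z i) rfl).or (decides_codeCovers (n := n) rfl hA
      (represents_fst _ _ _ _ _ _ _ _ _ _ _ _) (represents_snd _ _ _ _ _ _ _ _ _ _ _ _))
      ).eval_bit').trans (bitOf_congr ?_)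
    have : (load addrExpr : Expr 12).eval
        [n, k, N, f, o, q, z, bitOf (PairCovered G D z i), i, zc, bitOf (i < k), y]
        (memOf n A D) = D i := memOf_add n A D i
    rw [this]
    simp only [PairCovered, Nat.lt_succ_iff_lt_or_eq, or_and_right, exists_or, exists_eq_left]

/-- Each round resets the covered flag and the position, as `coveredLoop_runs` requires; register
`5` accumulates the conjunction over the pairs. -/
theorem pairLoop_runs (hY : 2 ≤ Y) (hE : Feasible W Y K exprs) (hkY : k ≤ Y)
    (hnY : n * n * n ≤ Y) {D : ℕ → ℕ}
    (hA : ∀ a b : Fin n, memOf n A D (a * n + b) ≠ 0 ↔ G.Adj a b) (f o y : ℕ) :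
    BoundedRuns W 12 Y pairLoop [n, k, N, f, o, 1, 0, 0, 0, bitOf (0 < n * n * n), 0, y]
      (memOf n A D)
      (n * n * n * (K + (k * (K + (K + K) + 1) + 1 + (K + (K + (K + (K + K))))) + 1) + 1)
      [n, k, N, f, o, bitOf (CodesCover G k D), n * n * n, 0, 0, 0, 0, y] (memOf n A D) := by
  have h := BoundedRuns.loop (W := W) (T := 12) (Y := Y)
    (B := K + (k * (K + (K + K) + 1) + 1 + (K + (K + (K + (K + K))))))
    (P := .seq (assign 10 posCondExpr) (.seq coveredLoop (.seq (assign 5 okExpr)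
    (.seq (assign 7 (const 0 : Expr 12)) (.seq (assign 8 (const 0 : Expr 12))
      (.seq (assign 6 pairSuccExpr) (assign 9 pairCondExpr)))))))
    9 (by norm_num) (n * n * n)
    (fun i => [n, k, N, f, o, bitOf (∀ z < i, PairOk G D z k), i, 0, 0, bitOf (i < n * n * n), 0, y])
    (fun _ => memOf n A D) (fun i hi => by simp [bitOf_of hi]) (fun i hi => ?_)
    (by simp [bitOf])
  · simpa only [pairLoop, bitOf_of (p := ∀ z < 0, PairOk G D z k) (by simp), ← codesCover_iff,
      bitOf_of_not (lt_irrefl (n * n * n))] using h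
  · refine (BoundedRuns.assign hY hE 10 posCondExpr (by simp [exprs]) (bitOf (0 < k))
      (eval_lt' _ _) (bitOf_le hY _) (by simp) rfl).seq
      ((coveredLoop_runs hY hE hkY hA _ _ _ _ _ _).seq
      ((BoundedRuns.assign hY hE 5 okExpr (by simp [exprs]) (bitOf (∀ z < i + 1, PairOk G D z k))
      ?_ (bitOf_le hY _) (by simp) rfl).seq
      ((BoundedRuns.assign hY hE 7 (const 0) (by simp [exprs]) 0 rfl (by omega) (by simp) rfl).seq
      ((BoundedRuns.assign hY hE 8 (const 0) (by simp [exprs]) 0 rfl (by omega) (by simp) rfl).seq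
      ((BoundedRuns.assign hY hE 6 pairSuccExpr (by simp [exprs]) (i + 1) rfl (by omega) (by simp) rfl).seq
      (BoundedRuns.assign hY hE 9 pairCondExpr (by simp [exprs]) (bitOf (i + 1 < n * n * n))
      (eval_lt' _ _) (bitOf_le hY _) (by simp) rfl))))))
    have hf := represents_fst (n := n) (memOf n A D) k N f o (bitOf (∀ z < i, PairOk G D z k)) i
      (bitOf (PairCovered G D i k)) k (bitOf (i < n * n * n)) 0 y
    have hs := represents_snd (n := n) (memOf n A D) k N f o (bitOf (∀ z < i, PairOk G D z k)) i
      (bitOf (PairCovered G D i k)) k (bitOf (i < n * n * n)) 0 y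
    have hne := decides_eq (T := 12) (m := memOf n A D)
      (l := [n, k, N, f, o, bitOf (∀ z < i, PairOk G D z k), i, bitOf (PairCovered G D i k), k,
        bitOf (i < n * n * n), 0, y]) fstExpr.2 sndExpr.2
    have e₁ : fstExpr.2.eval [n, k, N, f, o, bitOf (∀ z < i, PairOk G D z k), i,
        bitOf (PairCovered G D i k), k, bitOf (i < n * n * n), 0, y] (memOf n A D) =
        codeBase n i 1 := eval_base (n := n) rfl 1
    have e₂ : sndExpr.2.eval [n, k, N, f, o, bitOf (∀ z < i, PairOk G D z k), i,
        bitOf (PairCovered G D i k), k, bitOf (i < n * n * n), 0, y] (memOf n A D) =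
        codeBase n i 0 := eval_base (n := n) rfl 0
    rw [e₁, e₂, Fin.val_inj] at hne
    refine (((decides_of_bitOf (p := ∀ z < i, PairOk G D z k) rfl).and
      ((((decides_isEdge (n := n) rfl hA hf).and (decides_isEdge (n := n) rfl hA hs)).and hne.not).not.or
        (decides_of_bitOf (p := PairCovered G D i k) rfl))).eval_bit').trans (bitOf_congr ?_)
    have : PairOk G D i k ↔ ¬ ((s(codeBase n i 2, codeBase n i 1) ∈ G.edgeSet ∧
        s(codeBase n i 2, codeBase n i 0) ∈ G.edgeSet) ∧ ¬ codeBase n i 1 = codeBase n i 0) ∨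
        PairCovered G D i k := by
      simp only [PairOk, SimpleGraph.mem_edgeSet]
      tauto
    rw [← this]
    simp only [Nat.lt_succ_iff_lt_or_eq, or_imp, forall_and, forall_eq]

end Correctness

/-- When `1` is added to `t` in base `N`, a carry enters position `i` exactly if `N ^ i` divides `t
+ 1`. -/
theorem carry_digit {N t i : ℕ} (hN : 0 < N) :
    (t / N ^ i % N + bitOf (N ^ i ∣ t + 1) = N ↔ N ^ (i + 1) ∣ t + 1) ∧
      (t / N ^ i % N + bitOf (N ^ i ∣ t + 1)) * bitOf (¬ N ^ (i + 1) ∣ t + 1) =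
        (t + 1) / N ^ i % N := by
  have hlt := Nat.mod_lt (t / N ^ i) hN
  have hsd : (t + 1) / N ^ i = t / N ^ i + if N ^ i ∣ t + 1 then 1 else 0 := Nat.succ_div
  by_cases h : N ^ i ∣ t + 1
  · rw [if_pos h] at hsd
    obtain ⟨x, hx⟩ := h
    have hx' : (t + 1) / N ^ i = x := by
      rw [hx, Nat.mul_div_cancel_left _ (pow_pos hN i)]
    have hdvd : N ^ (i + 1) ∣ t + 1 ↔ N ∣ x := by
      rw [hx, pow_succ, Nat.mul_dvd_mul_iff_left (pow_pos hN i)]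
    have hmod : (t + 1) / N ^ i % N = if t / N ^ i % N + 1 = N then 0 else t / N ^ i % N + 1 := by
      have := Nat.div_add_mod (t / N ^ i) N
      rw [hsd, ← this, add_assoc, Nat.mul_add_mod, this]
      split_ifs with h'
      · rw [h', Nat.mod_self]
      · exact Nat.mod_eq_of_lt (by omega)
    have hiff : t / N ^ i % N + 1 = N ↔ N ∣ x := by
      rw [Nat.dvd_iff_mod_eq_zero, ← hx', hmod]
      split_ifs with h' <;> simp [h']
    rw [bitOf_of ⟨x, hx⟩, hdvd, hiff, hmod]
    refine ⟨Iff.rfl, ?_⟩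
    by_cases hd : N ∣ x
    · rw [bitOf_of_not (not_not.2 hd), if_pos (hiff.2 hd), mul_zero]
    · rw [bitOf_of hd, if_neg (mt hiff.1 hd), mul_one]
  · have h' : ¬ N ^ (i + 1) ∣ t + 1 := fun hd => h ((pow_dvd_pow N (Nat.le_succ i)).trans hd)
    rw [if_neg h] at hsd
    rw [bitOf_of_not h, bitOf_of h', hsd]
    simp only [h', iff_false, add_zero, mul_one, and_true]
    omega

theorem nextLoop_runs {W Y K n k N : ℕ} {A : ℕ → ℕ} (hY : 2 ≤ Y) (hE : Feasible W Y K exprs) (hkY : k ≤ Y) (hN : 0 < N)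
    (hNY : N ≤ Y) (t f o : ℕ) :
    BoundedRuns W 12 Y nextLoop [n, k, N, f, o, 0, 0, 0, 0, 0, bitOf (0 < k), 1]
      (memOf n A (digits N k t)) (k * (K + (K + (2 * K + (K + (K + K)))) + 1) + 1)
      [n, k, N, f, o, 0, 0, 0, k, 0, 0, bitOf (N ^ k ∣ t + 1)] (memOf n A (digits N k (t + 1))) := by
  have h := BoundedRuns.loop (W := W) (T := 12) (Y := Y) (B := K + (K + (2 * K + (K + (K + K)))))
    (P := .seq (assign 7 sumExpr) (.seq (assign 11 carryExpr) (.seq (storeAt addrExpr digitExpr)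
    (.seq (assign 7 (const 0 : Expr 12)) (.seq (assign 8 posSuccExpr) (assign 10 posCondExpr))))))
    10 (by norm_num) k
    (fun i => [n, k, N, f, o, 0, 0, 0, i, 0, bitOf (i < k), bitOf (N ^ i ∣ t + 1)])
    -- Half-way through the increment, the positions below `i` hold digits of `t + 1`, the others
    -- still those of `t`.
    (fun i => memOf n A fun j => if j < i then digits N k (t + 1) j else digits N k t j)
    (fun i hi => by simp [bitOf_of hi]) (fun i hi => ?_)
    (by simp [bitOf])
  · have e : (fun j => if j < k then digits N k (t + 1) j else digits N k t j) =
        digits N k (t + 1) := by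
      ext j
      unfold digits
      split_ifs <;> rfl
    simpa only [nextLoop, bitOf_of_not (lt_irrefl k), pow_zero, one_dvd, bitOf_of, e, not_lt_zero, if_false]
      using h
  · have hlt := Nat.mod_lt (t / N ^ i) hN
    have hbit : bitOf (N ^ i ∣ t + 1) ≤ 1 := by unfold bitOf; split_ifs <;> omega
    have hc := carry_digit (t := t) (i := i) hN
    refine (BoundedRuns.assign hY hE 7 sumExpr (by simp [exprs])
      (t / N ^ i % N + bitOf (N ^ i ∣ t + 1)) ?_ (by omega) (by simp) rfl).seq
      ((BoundedRuns.assign hY hE 11 carryExpr (by simp [exprs]) (bitOf (N ^ (i + 1) ∣ t + 1))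
      (by exact (eval_eq' _ _).trans (bitOf_congr hc.1)) (bitOf_le hY _) (by simp) rfl).seq
      ((BoundedRuns.storeAt hY hE addrExpr digitExpr (by simp [exprs]) (by simp [exprs]) (n * n + i)
      ((t + 1) / N ^ i % N) rfl ?_ ((Nat.mod_lt _ hN).le.trans hNY) ?_).seq
      ((BoundedRuns.assign hY hE 7 (const 0) (by simp [exprs]) 0 rfl (by omega) (by simp) rfl).seq
      ((BoundedRuns.assign hY hE 8 posSuccExpr (by simp [exprs]) (i + 1) rfl (by omega) (by simp) rfl).seq
      (BoundedRuns.assign hY hE 10 posCondExpr (by simp [exprs])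
      (bitOf (i + 1 < k)) (eval_lt' _ _) (bitOf_le hY _) (by simp) rfl)))))
    · refine congrArg (· + _) ((memOf_add n A _ i).trans ?_)
      simp [digits, hi]
    · refine (eval_mul _ _).trans ?_
      rw [(decides_of_bitOf (p := N ^ (i + 1) ∣ t + 1) rfl).eval_not]
      exact hc.2
    · rw [update_memOf]
      congr 1
      ext j
      rcases lt_trichotomy j i with h | h | h
      · simp [Function.update_of_ne h.ne, h, h.trans (Nat.lt_succ_self i)]
      · subst h
        simp [digits, hi]
      · simp [Function.update_of_ne h.ne', h.not_gt, show ¬ j < i + 1 by omega]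


end Boxicity

end WordRAM

/-! ### Correctness of the search -/

namespace WordRAM

namespace Boxicity

open WordRAM.Expr

/-- A bound for the running time of one round of `tupleLoop`. -/
def roundCost (K n k : ℕ) : ℕ :=
  K + (K + (n * n * n * (K + (k * (K + (K + K) + 1) + 1 + (K + (K + (K + (K + K))))) + 1) + 1 +
    (K + (K + (K + (K + (K + (k * (K + (K + (2 * K + (K + (K + K)))) + 1) + 1 +
      (K + (K + K))))))))))

section Correctness

variable {W Y K n k N : ℕ} [NeZero n] {G : SimpleGraph (Fin n)} {A : ℕ → ℕ}

/-- The counter `t` takes all values below `N ^ k`; the carry out of the last position signals `t +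
1 = N ^ k` and ends the loop. -/
theorem tupleLoop_runs (hY : 2 ≤ Y) (hE : Feasible W Y K exprs) (hkY : k ≤ Y)
    (hnY : n * n * n ≤ Y) (hN : 0 < N) (hNY : N ≤ Y)
    (hA : ∀ D, ∀ a b : Fin n, memOf n A D (a * n + b) ≠ 0 ↔ G.Adj a b) :
    BoundedRuns W 12 Y tupleLoop [n, k, N, 0, 1, 0, 0, 0, 0, 0, 0, 0]
      (memOf n A (digits N k 0)) (N ^ k * (roundCost K n k + 1) + 1)
      [n, k, N, bitOf (∃ t < N ^ k, CodesCover G k (digits N k t)), 0, 0, 0, 0, 0, 0, 0, 0]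
      (memOf n A (digits N k (N ^ k))) := by
  have h := BoundedRuns.loop (W := W) (T := 12) (Y := Y) (B := roundCost K n k)
    (P := .seq (assign 5 (const 1 : Expr 12)) (.seq (assign 9 pairCondExpr) (.seq pairLoop
    (.seq (assign 3 foundExpr) (.seq (assign 5 (const 0 : Expr 12))
    (.seq (assign 6 (const 0 : Expr 12)) (.seq (assign 11 (const 1 : Expr 12))
    (.seq (assign 10 posCondExpr) (.seq nextLoop (.seq (assign 4 moreExpr)
    (.seq (assign 8 (const 0 : Expr 12)) (assign 11 (const 0 : Expr 12)))))))))))))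
    4 (by norm_num) (N ^ k)
    (fun i => [n, k, N, bitOf (∃ t < i, CodesCover G k (digits N k t)), bitOf (i < N ^ k),
      0, 0, 0, 0, 0, 0, 0])
    (fun i => memOf n A (digits N k i))
    (fun i hi => by simp [bitOf_of hi]) (fun i hi => ?_)
    (by simp [bitOf])
  · simpa only [tupleLoop, bitOf_of_not (lt_irrefl (N ^ k)), bitOf_of (pow_pos hN k),
      bitOf_of_not (p := ∃ t < 0, CodesCover G k (digits N k t)) (by simp)] using h
  · refine (BoundedRuns.assign hY hE 5 (const 1) (by simp [exprs]) 1 rfl (by omega) (by simp)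
      rfl).seq
      ((BoundedRuns.assign hY hE 9 pairCondExpr (by simp [exprs]) (bitOf (0 < n * n * n))
      (eval_lt' _ _) (bitOf_le hY _) (by simp) rfl).seq
      ((pairLoop_runs hY hE hkY hnY (hA _) _ _ _).seq
      ((BoundedRuns.assign hY hE 3 foundExpr (by simp [exprs])
      (bitOf (∃ t < i + 1, CodesCover G k (digits N k t))) ?_ (bitOf_le hY _) (by simp) rfl).seq
      ((BoundedRuns.assign hY hE 5 (const 0) (by simp [exprs]) 0 rfl (by omega) (by simp) rfl).seq
      ((BoundedRuns.assign hY hE 6 (const 0) (by simp [exprs]) 0 rfl (by omega) (by simp) rfl).seq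
      ((BoundedRuns.assign hY hE 11 (const 1) (by simp [exprs]) 1 rfl (by omega) (by simp) rfl).seq
      ((BoundedRuns.assign hY hE 10 posCondExpr (by simp [exprs]) (bitOf (0 < k))
      (eval_lt' _ _) (bitOf_le hY _) (by simp) rfl).seq
      ((nextLoop_runs hY hE hkY hN hNY _ _ _).seq
      ((BoundedRuns.assign hY hE 4 moreExpr (by simp [exprs]) (bitOf (i + 1 < N ^ k))
      ?_ (bitOf_le hY _) (by simp) rfl).seq
      ((BoundedRuns.assign hY hE 8 (const 0) (by simp [exprs]) 0 rfl (by omega) (by simp) rfl).seq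
      (BoundedRuns.assign hY hE 11 (const 0) (by simp [exprs]) 0 rfl (by omega) (by simp)
        rfl)))))))))))
    · refine (((decides_of_bitOf (p := ∃ t < i, CodesCover G k (digits N k t)) rfl).or
        (decides_of_bitOf (p := CodesCover G k (digits N k i)) rfl)).eval_bit').trans
        (bitOf_congr ?_)
      simp only [Nat.lt_succ_iff_lt_or_eq, or_and_right, exists_or, exists_eq_left]
    · refine ((decides_of_bitOf (p := N ^ k ∣ i + 1) rfl).eval_not).trans (bitOf_congr ?_)
      constructor
      · intro h
        exact lt_of_le_of_ne hi fun h' => h (h' ▸ dvd_rfl)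
      · intro h h'
        exact absurd (Nat.le_of_dvd (Nat.succ_pos i) h') (by omega)

/-- Every tuple of codes is the digit sequence of some `t < N ^ k`. -/
theorem exists_tuple_iff (hn : N = numCodes n) :
    (∃ t < N ^ k, CodesCover G k (digits N k t)) ↔ CoLineBoxicityAtMost n G k := by
  subst hn
  rw [coLineBoxicityAtMost_iff]
  have hN : 0 < numCodes n := by have := NeZero.pos n; unfold numCodes; positivity
  constructor
  · rintro ⟨t, -, h⟩
    refine ⟨_, fun j hj => ?_, h⟩
    simp only [digits, hj, if_true]
    exact Nat.mod_lt _ hN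
  · rintro ⟨D, hD, h⟩
    let E : Fin k → Fin (numCodes n) := fun j => ⟨D j, hD j j.2⟩
    refine ⟨finFunctionFinEquiv E, (finFunctionFinEquiv E).2, fun c a b hca hcb hab => ?_⟩
    obtain ⟨j, hj, H⟩ := h c a b hca hcb hab
    refine ⟨j, hj, ?_⟩
    have e := congrArg Fin.val (congrFun (finFunctionFinEquiv.symm_apply_apply E) ⟨j, hj⟩)
    rw [finFunctionFinEquiv_symm_apply_val] at e
    rwa [digits, if_pos hj, e]

theorem input_mem_adj (G : SimpleGraph (Fin n)) (D : ℕ → ℕ) (a b : Fin n) :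
    memOf n (input G k).mem D (a * n + b) ≠ 0 ↔ G.Adj a b := by
  have ha := a.2
  have hb := b.2
  have hlt : a.val * n + b.val < n * n := by nlinarith
  have hn : 0 < n := NeZero.pos n
  simp only [memOf, if_pos hlt, input, ne_eq, ite_eq_right_iff, one_ne_zero, imp_false, not_not]
  constructor
  · rintro ⟨i, j, h, hij⟩
    have e₁ : a.val = i.val := by
      have := congrArg (· / n) h
      simpa [Nat.add_div_of_dvd_right, Nat.mul_add_div, mul_comm _ n, Nat.mul_add_div hn,
        Nat.div_eq_of_lt] using this
    have e₂ : b.val = j.val := by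
      rw [e₁] at h
      omega
    rwa [Fin.ext e₁, Fin.ext e₂]
  · exact fun h => ⟨a, b, rfl, h⟩

end Correctness

/-- Memory beyond the matrix starts at zero, which is the tuple for `t = 0`; no initialization is
needed. -/
theorem input_mem_eq {n k : ℕ} (G : SimpleGraph (Fin n)) :
    (input G k).mem = memOf n (input G k).mem (digits N k 0) := by
  ext a
  unfold memOf
  split_ifs with h
  · rfl
  · have : ¬ ∃ i j : Fin n, a = i.val * n + j.val ∧ G.Adj i j := by
      rintro ⟨i, j, rfl, -⟩
      have := i.2
      have := j.2
      apply h
      nlinarith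
    simp [input, this, digits]

theorem matches_input {n k : ℕ} (G : SimpleGraph (Fin n)) :
    Matches 12 [n, k, 0, 0, 0, 0, 0, 0, 0, 0, 0, 0] (input G k).mem (input G k) := by
  refine ⟨rfl, fun r hr => ?_⟩
  interval_cases r <;> rfl

theorem eval_numExpr (l : List ℕ) (m : ℕ → ℕ) :
    numExpr.eval l m = numCodes (l.getD 0 0) := by
  simp only [numExpr, numCodes, eval_mul, eval_add, eval_div, eval_const, eval_reg, Fin.val_zero]

/-- A bound for the running time of `program`. -/
def runCost (K n k : ℕ) : ℕ :=
  K + (K + (K + ((if k < n then numCodes n ^ k else 0) * (roundCost K n k + 1) + 1 + K)))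

/-- For `n ≤ k`, including `n = 0` where codes make no sense, the flags are preset to "found" and
"no more tuples", and the search is skipped. -/
theorem program_exec {W Y K n k : ℕ} (hY : 2 ≤ Y) (hE : Feasible W Y K exprs) (hk : 1 ≤ k)
    (hkY : k ≤ Y) (hnY : n ≤ Y) (hn3Y : n * n * n ≤ Y) (hNY : numCodes n ≤ Y)
    (G : SimpleGraph (Fin n)) :
    ∃ t s, Exec W program (input G k) t s ∧ t ≤ runCost K n k ∧
      s.reg 0 = bitOf (CoLineBoxicityAtMost n G k) := by
  have hb : Bounded Y [n, k, 0, 0, 0, 0, 0, 0, 0, 0, 0, 0] (input G k).mem := by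
    refine ⟨by simp; omega, fun a => ?_⟩
    simp only [input]
    split_ifs <;> omega
  have hinit : ∀ {B m'} {l' : List ℕ},
      BoundedRuns W 12 Y tupleLoop [n, k, numCodes n, bitOf (¬ k < n), bitOf (k < n),
        0, 0, 0, 0, 0, 0, 0] (input G k).mem B l' m' →
      l'.getD 3 0 = bitOf (CoLineBoxicityAtMost n G k) → 0 < l'.length →
      BoundedRuns W 12 Y program [n, k, 0, 0, 0, 0, 0, 0, 0, 0, 0, 0] (input G k).mem
        (K + (K + (K + (B + K)))) (l'.set 0 (bitOf (CoLineBoxicityAtMost n G k))) m' :=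
    fun {B m' l'} h h₃ hl =>
      (BoundedRuns.assign hY hE 2 numExpr (by simp [exprs]) (numCodes n) (by exact eval_numExpr _ _) hNY (by simp)
        rfl).seq
      ((BoundedRuns.assign hY hE 3 foundInitExpr (by simp [exprs]) (bitOf (¬ k < n))
        (decides_lt _ _).eval_not (bitOf_le hY _) (by simp) rfl).seq
      ((BoundedRuns.assign hY hE 4 moreInitExpr (by simp [exprs]) (bitOf (k < n))
        (eval_lt' _ _) (bitOf_le hY _) (by simp) rfl).seq
      (h.seq (BoundedRuns.assign hY hE 0 (reg 3) (by simp [exprs])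
        (bitOf (CoLineBoxicityAtMost n G k)) h₃ (bitOf_le hY _) hl rfl))))
  have fin : ∀ {B m'} {l' : List ℕ}, BoundedRuns W 12 Y program [n, k, 0, 0, 0, 0, 0, 0, 0, 0, 0, 0] (input G k).mem
        B (l'.set 0 (bitOf (CoLineBoxicityAtMost n G k))) m' →
      B ≤ runCost K n k → 0 < l'.length →
      ∃ t s, Exec W program (input G k) t s ∧ t ≤ runCost K n k ∧
        s.reg 0 = bitOf (CoLineBoxicityAtMost n G k) := by
    intro B m' l' h hB hl
    obtain ⟨t, s, x, ht, hs⟩ := (h hb).1 _ (matches_input G)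
    refine ⟨t, s, x, ht.trans hB, (hs.2 0 (by norm_num)).trans ?_⟩
    simp [hl]
  by_cases hkn : k < n
  · have : NeZero n := ⟨by omega⟩
    have hN : 0 < numCodes n := by have := NeZero.pos n; unfold numCodes; positivity
    have h := tupleLoop_runs (k := k) (N := numCodes n) hY hE hkY hn3Y hN hNY (input_mem_adj (k := k) G)
    rw [← input_mem_eq G, exists_tuple_iff rfl] at h
    rw [bitOf_of_not (not_not.2 hkn), bitOf_of hkn] at hinit
    refine fin (hinit h rfl (Nat.succ_pos _)) (Eq.le ?_) (Nat.succ_pos _)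
    rw [runCost, if_pos hkn]
  · have h' : BoundedRuns W 12 Y tupleLoop [n, k, numCodes n, bitOf (¬ k < n), bitOf (k < n),
        0, 0, 0, 0, 0, 0, 0] (input G k).mem 1 [n, k, numCodes n, bitOf (¬ k < n), bitOf (k < n),
        0, 0, 0, 0, 0, 0, 0] (input G k).mem := by
      unfold tupleLoop
      exact (BoundedRuns.loop (B := 0) 4 (by norm_num) 0
        (fun _ => [n, k, numCodes n, bitOf (¬ k < n), bitOf (k < n), 0, 0, 0, 0, 0, 0, 0])
        (fun _ => (input G k).mem) (by simp) (by simp) (bitOf_of_not hkn)).mono (by simp)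
    refine fin (hinit h' ?_ (Nat.succ_pos _)) ?_ (Nat.succ_pos _)
    · refine (bitOf_of hkn).trans (bitOf_of ?_).symm
      exact coLineBoxicityAtMost_of_le n k G (by omega)
    · rw [runCost, if_neg hkn]
      omega

end Boxicity

end WordRAM

/-! ### The time bound -/

namespace WordRAM

namespace Boxicity

/-- This bounds `k * (3/4) ^ k` by `3`; the summand `3` makes the induction close, as `3 * (k + 4) ≤
4 * (k + 3)`. -/
theorem mul_three_pow_le (k : ℕ) : (k + 3) * 3 ^ k ≤ 3 * 4 ^ k := by
  induction k with
  | zero => simp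
  | succ k ih =>
    rw [pow_succ, pow_succ]
    have : 0 < 3 ^ k := by positivity
    nlinarith

/-- The threshold is `4 * 65536`: beyond it `4 * (n / 2 + 65536) ≤ 3 * n`. -/
theorem four_mul_numCodes_le {n : ℕ} (hn : 262144 ≤ n) : 4 * numCodes n ≤ 3 * n ^ 5 := by
  have key : ∀ x, 4 * x ≤ 3 * n → 4 * (n * n * n * n * x) ≤ 3 * n ^ 5 := by
    intro x h
    calc 4 * (n * n * n * n * x) = n * n * n * n * (4 * x) := by ring
      _ ≤ n * n * n * n * (3 * n) := Nat.mul_le_mul_left _ h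
      _ = 3 * n ^ 5 := by ring
  have := Nat.div_mul_le_self n 2
  exact key (n / 2 + 65536) (by linarith)

theorem exists_numCodes_pow_mul_le :
    ∃ C : ℕ, ∀ n k : ℕ, k < n → numCodes n ^ k * k ≤ C * n ^ (5 * k) := by
  -- The threshold stays opaque, so that `numCodes n₀ ^ n₀` is never evaluated. It bounds the case
  -- `n ≤ n₀`, where `k < n₀` as well.
  obtain ⟨n₀, h₀⟩ : ∃ n₀ : ℕ, 262144 ≤ n₀ := ⟨_, le_rfl⟩
  refine ⟨numCodes n₀ ^ n₀ * n₀ + 3, fun n k hk => ?_⟩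
  rcases le_total n₀ n with hn | hn
  · have h₁ := four_mul_numCodes_le (h₀.trans hn)
    have h₂ : 4 ^ k * numCodes n ^ k ≤ 3 ^ k * n ^ (5 * k) := by
      rw [← mul_pow, pow_mul, ← mul_pow]
      exact Nat.pow_le_pow_left h₁ k
    have h₃ := mul_three_pow_le k
    have h₄ : 4 ^ k * (numCodes n ^ k * k) ≤ 4 ^ k * (3 * n ^ (5 * k)) := by
      calc 4 ^ k * (numCodes n ^ k * k) = 4 ^ k * numCodes n ^ k * k := by ring
        _ ≤ 3 ^ k * n ^ (5 * k) * k := Nat.mul_le_mul_right _ h₂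
        _ = (k * 3 ^ k) * n ^ (5 * k) := by ring
        _ ≤ (3 * 4 ^ k) * n ^ (5 * k) := Nat.mul_le_mul_right _
          ((Nat.mul_le_mul_right _ (Nat.le_add_right k 3)).trans h₃)
        _ = 4 ^ k * (3 * n ^ (5 * k)) := by ring
    exact (Nat.le_of_mul_le_mul_left h₄ (by positivity)).trans
      (Nat.mul_le_mul_right _ (Nat.le_add_left _ _))
  · have hmono : numCodes n ≤ numCodes n₀ := by unfold numCodes; gcongr
    have hpos : 1 ≤ numCodes n₀ := by
      have : 0 < n₀ := by omega
      unfold numCodes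
      exact Nat.succ_le_of_lt (by positivity)
    have h₁ : numCodes n ^ k * k ≤ numCodes n₀ ^ n₀ * n₀ :=
      Nat.mul_le_mul ((Nat.pow_le_pow_left hmono k).trans (Nat.pow_le_pow_right hpos (by omega)))
        (by omega)
    have h₂ : 1 ≤ n ^ (5 * k) := Nat.one_le_pow _ _ (by omega)
    exact (h₁.trans (Nat.le_add_right _ 3)).trans (Nat.le_mul_of_pos_right _ h₂)

/-- Up to constants, all terms are of order `1`, `k`, `n ^ 3` or `n ^ 3 * k`, and the last
dominates. -/
theorem roundCost_le (K n k : ℕ) (hk : 1 ≤ k) (hn : 1 ≤ n) :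
    roundCost K n k + 1 ≤ (40 * K + 40) * (n ^ 3 * k) := by
  obtain ⟨c, hc⟩ : ∃ c, c = n ^ 3 := ⟨_, rfl⟩
  have hc1 : 1 ≤ c := hc ▸ Nat.one_le_pow _ _ hn
  have e : n * n * n = c := by rw [hc]; ring
  rw [roundCost, e, ← hc]
  obtain ⟨p, hp⟩ : ∃ p, p = c * k := ⟨_, rfl⟩
  have h₁ : c ≤ p := by rw [hp]; exact Nat.le_mul_of_pos_right _ hk
  have h₂ : k ≤ p := by rw [hp]; exact Nat.le_mul_of_pos_left _ hc1
  have h₃ : K * c ≤ K * p := Nat.mul_le_mul_left _ h₁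
  have h₄ : K * k ≤ K * p := Nat.mul_le_mul_left _ h₂
  have h₅ : K * 1 ≤ K * p := Nat.mul_le_mul_left _ (hc1.trans h₁)
  have h₆ : K * (c * k) = K * p := by rw [hp]
  rw [← hp]
  nlinarith

theorem exists_runCost_le (K : ℕ) :
    ∃ C : ℕ, ∀ n k : ℕ, 1 ≤ k → runCost K n k ≤ C * n ^ (5 * k + 3) + C := by
  obtain ⟨C, hC⟩ := exists_numCodes_pow_mul_le
  refine ⟨(40 * K + 40) * C + 4 * K + 1, fun n k hk => ?_⟩
  unfold runCost
  split_ifs with hkn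
  · have h : numCodes n ^ k * (roundCost K n k + 1) ≤ (40 * K + 40) * C * n ^ (5 * k + 3) := by
      calc numCodes n ^ k * (roundCost K n k + 1)
          ≤ numCodes n ^ k * ((40 * K + 40) * (n ^ 3 * k)) :=
            Nat.mul_le_mul_left _ (roundCost_le K n k hk (by omega))
        _ = (40 * K + 40) * n ^ 3 * (numCodes n ^ k * k) := by ring
        _ ≤ (40 * K + 40) * n ^ 3 * (C * n ^ (5 * k)) := Nat.mul_le_mul_left _ (hC n k hkn)
        _ = (40 * K + 40) * C * n ^ (5 * k + 3) := by ring
    nlinarith [Nat.zero_le (n ^ (5 * k + 3) * (4 * K + 1)), Nat.zero_le ((40 * K + 40) * C)]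
  · rw [zero_mul]
    nlinarith [Nat.zero_le (((40 * K + 40) * C + 4 * K + 1) * n ^ (5 * k + 3)),
      Nat.zero_le ((40 * K + 40) * C)]

/-- The exponent is `4 + 16 + 1`: four factors `n`, `65536 = 2 ^ 16`, and a factor `2` for the sum.
-/
theorem numCodes_le_pow {n X : ℕ} (hn : n ≤ X) (hX : 2 ≤ X) : numCodes n ≤ X ^ 21 := by
  have h₁ : n / 2 ≤ X ^ 16 := ((Nat.div_le_self _ _).trans hn).trans (Nat.le_self_pow (by norm_num) X)
  have h₂ : 65536 ≤ X ^ 16 := (show 65536 = 2 ^ 16 by norm_num).le.trans (Nat.pow_le_pow_left hX 16)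
  calc numCodes n ≤ X * X * X * X * (X ^ 16 + X ^ 16) := by unfold numCodes; gcongr
    _ = 2 * X ^ 20 := by ring
    _ ≤ X * X ^ 20 := Nat.mul_le_mul_right _ hX
    _ = X ^ 21 := by ring

theorem exists_feasible : ∃ c K : ℕ, ∀ X : ℕ, 2 ≤ X → Feasible (X ^ c) (X ^ 21) K exprs := by
  have hsum : ∀ (f : Expr 12 → ℕ) (es : List (Expr 12)), ∀ e ∈ es, f e ≤ (es.map f).sum :=
    fun f es e he => List.single_le_sum (by simp) _ (List.mem_map_of_mem he)
  -- The program has finitely many expressions, so sums over all of them bound each cost and each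
  -- weight.
  refine ⟨21 * (exprs.map Expr.weight).sum + 1, (exprs.map fun e => e.cost + 2).sum,
    fun X hX e he => ⟨hsum (fun e => e.cost + 2) exprs e he, ?_⟩⟩
  rw [← pow_mul]
  have := hsum Expr.weight exprs e he
  exact Nat.pow_lt_pow_right (by omega) (by omega)

theorem decidableInTime_runCost :
    ∃ K, DecidableInTime CoLineBoxicityAtMost fun n k => runCost K n k := by
  obtain ⟨c, K, hcK⟩ := exists_feasible
  refine ⟨K, program, c, fun n k hk G => ?_⟩
  have hX : 2 ≤ n + k + 2 := by omega
  have hself : n + k + 2 ≤ (n + k + 2) ^ 21 := Nat.le_self_pow (by norm_num) _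
  have hcube : n * n * n ≤ (n + k + 2) ^ 21 := by
    calc n * n * n ≤ (n + k + 2) * (n + k + 2) * (n + k + 2) := by gcongr <;> omega
      _ = (n + k + 2) ^ 3 := by ring
      _ ≤ (n + k + 2) ^ 21 := Nat.pow_le_pow_right (by omega) (by norm_num)
  obtain ⟨t, s, x, ht, hs⟩ := program_exec (hX.trans hself) (hcK _ hX) hk (by omega) (by omega)
    hcube (numCodes_le_pow (by omega) hX) G
  exact ⟨t, s, x, ht, hs⟩

end Boxicity

theorem DecidableInTime.mono {Q : (n : ℕ) → SimpleGraph (Fin n) → ℕ → Prop} {T T' : ℕ → ℕ → ℕ}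
    (h : DecidableInTime Q T) (hT : ∀ n k, 1 ≤ k → T n k ≤ T' n k) : DecidableInTime Q T' := by
  obtain ⟨P, c, h⟩ := h
  refine ⟨P, c, fun n k hk G => ?_⟩
  obtain ⟨t, s, x, ht, hs⟩ := h n k hk G
  exact ⟨t, s, x, ht.trans (hT n k hk), hs⟩

end WordRAM

theorem mainTheorem5 :
    (∃ C : ℕ, WordRAM.DecidableInTime CoLineBoxicityAtMost
      (fun n k => C * n ^ (5 * k + 3) + C)) ∧
    WordRAM.InXP CoLineBoxicityAtMost := by
  obtain ⟨K, hK⟩ := WordRAM.Boxicity.decidableInTime_runCost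
  obtain ⟨C, hC⟩ := WordRAM.Boxicity.exists_runCost_le K
  have h := hK.mono hC
  -- One function serves as factor and as exponent: `2 * C` for the two summands of the bound, `5 *
  -- k + 3` for the power.
  refine ⟨⟨C, h⟩, fun k => 2 * C + (5 * k + 3), ?_, h.mono fun n k _ => ?_⟩
  · exact (Primrec.nat_add.comp (Primrec.const _) (Primrec.nat_add.comp
      (Primrec.nat_mul.comp (Primrec.const 5) Primrec.id) (Primrec.const 3))).to_comp
  · have h₁ : n ^ (5 * k + 3) ≤ (n + 1) ^ (2 * C + (5 * k + 3)) :=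
      (Nat.pow_le_pow_left (Nat.le_succ n) _).trans
        (Nat.pow_le_pow_right (Nat.succ_pos n) (Nat.le_add_left _ _))
    have h₂ : 1 ≤ (n + 1) ^ (2 * C + (5 * k + 3)) := Nat.one_le_pow _ _ (Nat.succ_pos n)
    calc C * n ^ (5 * k + 3) + C
        ≤ C * (n + 1) ^ (2 * C + (5 * k + 3)) + C * (n + 1) ^ (2 * C + (5 * k + 3)) :=
          Nat.add_le_add (Nat.mul_le_mul_left _ h₁) (Nat.le_mul_of_pos_right _ h₂)
      _ = 2 * C * (n + 1) ^ (2 * C + (5 * k + 3)) := by ring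
      _ ≤ _ := Nat.mul_le_mul_right _ (Nat.le_add_right _ _)
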